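/- Fix $\omega_0,\gamma,\theta>0$ and put $\omega=2\pi/\theta$. For $N\in\{0,1,2,\dots\}$ and $\nu\in\mathbb R$ consider the forced, boundary-damped chain on $\mathbb Z_N=\{-N,\dots,N\}$, $$\ddot q_x=\Delta q_x-\omega_0^2q_x-\gamma\big(\delta_{-N}(x)+\delta_N(x)\big)\dot q_x-\nu\Big(V'(q_x)-\nabla U'(q_x-q_{x-1})\Big)+\mathcal F(t/\theta)\,\delta_{x,0},\qquad x\in\mathbb Z_N,$$ where $\Delta f_x=f_{x+1}+f_{x-1}-2f_x$, $\nabla f_x=f_{x+1}-f_x$, with the Neumann convention $q_{N+1}=q_N$, $q_{-N-1}=q_{-N}$. The potentials $V,U:\mathbb R\to\mathbb R$ are of class $C^2$ with $\|V''\|_\infty+\|U''\|_\infty<\infty$ and $V'(0)=0$, and the force is $\mathcal F(t/\theta)=\sum_{m\in\mathbb Z}\hat F_me^{im\omega t}$ with $\hat F_0=0$, $\hat F_{-m}=\overline{\hat F_m}$ and $0<\sum_m (m|\hat F_m|)^2<\infty$. Let $$\delta_*=\inf\big\{|(m\omega)^2-w^2|:\ m\in\mathbb Z,\ w\in[\omega_0,\sqrt{\omega_0^2+4}]\big\},\qquad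 \mathfrak V=\|V''\|_\infty+3\|U''\|_\infty,\qquad \nu_0=\frac{\delta_*}{\mathfrak V}$$ (with $\nu_0=0$ if $\delta_*=0$, and $\nu_0=+\infty$ if $\delta_*>0$ and $\mathfrak V=0$). Theorem. For all real $K,M$ there are constants $C_1,A,\rho>0$, depending only on $\omega_0,\gamma,\theta,K,M$ (in particular independent of $N$ and $\nu$), such that for all $V,U,\hat F$ as above with $\mathfrak V\le K$ and $\sup_m|\hat F_m|\le M$, all $N\ge 0$ and all $\nu$ with $|\nu|<\nu_0\wedge C_1$, the chain has a unique $\theta$-periodic solution $(q_{x,\mathrm p}(t;\nu))_{x\in\mathbb Z_N}$, and with $p_{x,\mathrm p}=\dot q_{x,\mathrm p}$ one has, for every $x\in\mathbb Z_N$, $$|q_{x,\mathrm p}(t;\nu)|\le A e^{-\rho|x|}\quad (t\in[0,\theta])\qquad\text{and}\qquad \int_0^\theta p_{x,\mathrm p}^2(t;\nu)\,dt\le A e^{-\rho|x|}.$$ -/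

import Mathlib

namespace ForcedChain

noncomputable section

/-- The set of sites `{-N, …, N}` of the chain. -/
abbrev Site (N : ℕ) : Type := ↥(Set.Icc (-(N : ℤ)) (N : ℤ))

/-- Extension of `(f_x)`, `x ∈ {-N, …, N}`, to `ℤ` which is constant to the left of `-N` and to the
right of `N`; in particular `f_{N+1} = f_N` and `f_{-N-1} = f_{-N}` (Neumann boundary condition). -/
def ext {N : ℕ} (f : Site N → ℝ) : ℤ → ℝ :=
  Set.IccExtend (by omega : -(N : ℤ) ≤ (N : ℤ)) f

/-- Discrete gradient `∇ g_x = g_{x+1} - g_x`. -/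
def grad (g : ℤ → ℝ) (x : ℤ) : ℝ := g (x + 1) - g x

/-- Discrete Neumann Laplacian `Δ f_x = f_{x+1} + f_{x-1} - 2 f_x`. -/
def lap {N : ℕ} (f : Site N → ℝ) (x : Site N) : ℝ :=
  ext f ((x : ℤ) + 1) + ext f ((x : ℤ) - 1) - 2 * f x

/-- Kronecker delta `δ_y(x)`. -/
def delta (y x : ℤ) : ℝ := if x = y then 1 else 0

/-- The nonlinear term `W_x(f) = V'(f_x) - ∇ U'(f_x - f_{x-1})`. -/
def anharm (V U : ℝ → ℝ) {N : ℕ} (f : Site N → ℝ) (x : Site N) : ℝ :=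
  deriv V (f x) - grad (fun y => deriv U (ext f y - ext f (y - 1))) (x : ℤ)

/-- The frequency `ω = 2π/θ`. -/
def freq (θ : ℝ) : ℝ := 2 * Real.pi / θ

/-- Conditions on the Fourier coefficients of the force: `F_0 = 0`, `F_{-m} = conj F_m` and
`0 < ∑ (m |F_m|)² < ∞`. -/
structure IsForcing (F : ℤ → ℂ) : Prop where
  zero : F 0 = 0
  conj : ∀ m : ℤ, F (-m) = (starRingEnd ℂ) (F m)
  summable : Summable fun m : ℤ => ((m : ℝ) * ‖F m‖) ^ 2
  pos : 0 < ∑' m : ℤ, ((m : ℝ) * ‖F m‖) ^ 2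

/-- The force `∑_m F_m e^{i m ω t}` (the sum is real by the symmetry of the coefficients). -/
def force (θ : ℝ) (F : ℤ → ℂ) (t : ℝ) : ℝ :=
  (∑' m : ℤ, F m * Complex.exp (Complex.I * ((m : ℂ) * (freq θ : ℂ) * (t : ℂ)))).re

/-- Potentials of class `C²` with bounded second derivative. -/
structure IsPotential (G : ℝ → ℝ) : Prop where
  contDiff : ContDiff ℝ 2 G
  bounded : BddAbove (Set.range fun r : ℝ => |deriv (deriv G) r|)

/-- `‖G''‖_∞`. -/
def supSecond (G : ℝ → ℝ) : ℝ := ⨆ r : ℝ, |deriv (deriv G) r|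

/-- `𝔙 = ‖V''‖_∞ + 3 ‖U''‖_∞`. -/
def frakV (V U : ℝ → ℝ) : ℝ := supSecond V + 3 * supSecond U

/-- `δ_* = inf { |(mω)² - w²| : m ∈ ℤ, w ∈ [ω₀, √(ω₀² + 4)] }`. -/
def deltaStar (ω₀ θ : ℝ) : ℝ :=
  sInf {d : ℝ | ∃ m : ℤ, ∃ w ∈ Set.Icc ω₀ (Real.sqrt (ω₀ ^ 2 + 4)),
    d = |((m : ℝ) * freq θ) ^ 2 - w ^ 2|}

/-- `ν₀ = δ_* / 𝔙`, as an extended nonnegative number: it is `0` when `δ_* = 0`, and `∞` when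
`δ_* > 0` and `𝔙 = 0` (harmonic chain). -/
def nuZero (ω₀ θ : ℝ) (V U : ℝ → ℝ) : ENNReal :=
  ENNReal.ofReal (deltaStar ω₀ θ) / ENNReal.ofReal (frakV V U)

/-- `q` is a (classical, global) `θ`-periodic solution of the equations of motion
`q̈_x = Δ q_x - ω₀² q_x - γ (δ_{-N}(x) + δ_N(x)) q̇_x - ν W_x(q) + F(t) δ_0(x)`, `x ∈ {-N, …, N}`. -/
structure IsPeriodicSolution (ω₀ γ θ : ℝ) (V U : ℝ → ℝ) (F : ℤ → ℂ) (N : ℕ) (ν : ℝ)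
    (q : Site N → ℝ → ℝ) : Prop where
  differentiable : ∀ x, Differentiable ℝ (q x)
  equation : ∀ x, ∀ t : ℝ, HasDerivAt (deriv (q x))
    (lap (fun y => q y t) x - ω₀ ^ 2 * q x t
      - γ * (delta (-(N : ℤ)) x + delta (N : ℤ) x) * deriv (q x) t
      - ν * anharm V U (fun y => q y t) x
      + force θ F t * delta 0 x) t
  periodic : ∀ x, Function.Periodic (q x) θ

end

end ForcedChain

namespace ForcedChain

/-! The proof treats the chain as a harmonic one driven by a periodic source. In the `m`-th Fourier
mode, with `λ = (mω)²`, the linear equation reads `(ω₀² - λ - Δ + i b) z = g`, where `b` is the real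
diagonal boundary damping. Pairing with `w² z̄` and taking real parts removes `b`. For a weight `w`
of slowly varying logarithm, `-Δ` has weighted form between `-κ` and `4 + κ`, so non-resonance makes
the operator coercive of order `c (1 + λ)`, uniformly in `N` (`coercive_estimate`). Since `∑ 1 / (1
+ (mω)²)` converges, adding the modes bounds the weighted `ℓ²` norm of the solution at every time
(`IsLinearSolution.wsum_le`).

With `w = 1` this a priori bound gives uniqueness for the linear problem. By finite dimension it
also gives existence, through the monodromy map. The anharmonic term is Lipschitz with constant
proportional to `K`, so for small `ν` the response map is a contraction on continuous loops, and its
fixed point is the periodic solution.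

With `w_x = exp (ρ|x|)` and small `ρ`, the same bound applies to the solution just found. Its
weighted norm is finite because the chain is finite, so the anharmonic part can be absorbed. What
remains is the force at the origin, where `w_0 = 1`. Hence exponential decay with constants
independent of `N` and `ν`. -/

/-! ### Fourier coefficients of periodic functions. -/

open Complex in
/-- The character `e^{i m ω t}`, `ω = 2π/θ`. -/
noncomputable def character (θ : ℝ) (m : ℤ) (t : ℝ) : ℂ :=
  exp (I * ((m : ℂ) * (freq θ : ℂ) * (t : ℂ)))

/-- The `m`-th Fourier coefficient of a real `θ`-periodic function. -/
noncomputable def fcoeff (θ : ℝ) (f : ℝ → ℝ) (m : ℤ) : ℂ :=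
  (θ : ℂ)⁻¹ * ∫ t in (0 : ℝ)..θ, character θ (-m) t * (f t : ℂ)

theorem norm_character (θ : ℝ) (m : ℤ) (t : ℝ) : ‖character θ m t‖ = 1 := by
  rw [character, show Complex.I * ((m : ℂ) * (freq θ : ℂ) * (t : ℂ))
    = ((m * freq θ * t : ℝ) : ℂ) * Complex.I by push_cast; ring]
  exact Complex.norm_exp_ofReal_mul_I _

theorem hasDerivAt_character (θ : ℝ) (m : ℤ) (t : ℝ) :
    HasDerivAt (character θ m) (Complex.I * (m * freq θ) * character θ m t) t := by
  have h : HasDerivAt (fun s : ℝ => Complex.I * ((m : ℂ) * (freq θ : ℂ) * (s : ℂ)))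
      (Complex.I * ((m : ℂ) * (freq θ : ℂ) * 1)) t :=
    ((HasDerivAt.ofReal_comp (hasDerivAt_id t)).const_mul _).const_mul _ |>.congr_deriv (by simp)
  exact h.cexp.congr_deriv (by rw [character]; ring)

theorem continuous_character (θ : ℝ) (m : ℤ) : Continuous (character θ m) :=
  continuous_iff_continuousAt.2 fun t => (hasDerivAt_character θ m t).continuousAt

theorem character_period {θ : ℝ} (hθ : 0 < θ) (m : ℤ) : character θ m θ = 1 := by
  have h0 : (θ : ℂ) ≠ 0 := by exact_mod_cast hθ.ne'
  rw [character, Complex.exp_eq_one_iff]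
  exact ⟨m, by rw [freq]; push_cast; field_simp⟩

theorem character_zero (θ : ℝ) (m : ℤ) : character θ m 0 = 1 := by simp [character]

theorem fourier_eq_character {θ : ℝ} (m : ℤ) (t : ℝ) :
    fourier m (t : AddCircle θ) = character θ m t := by
  rw [fourier_coe_apply, character, freq]
  congr 1; push_cast; ring

theorem fcoeff_eq_fourierCoeffOn {θ : ℝ} (hθ : 0 < θ) (f : ℝ → ℝ) (m : ℤ) :
    fcoeff θ f m = fourierCoeffOn hθ (fun t => (f t : ℂ)) m := by
  rw [fourierCoeffOn_eq_integral, fcoeff]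
  simp only [fourier_eq_character, sub_zero, smul_eq_mul, Complex.real_smul, one_div,
    Complex.ofReal_inv]

theorem fcoeff_add {θ : ℝ} {f g : ℝ → ℝ} (hf : Continuous f) (hg : Continuous g) (m : ℤ) :
    fcoeff θ (fun t => f t + g t) m = fcoeff θ f m + fcoeff θ g m := by
  have hc := continuous_character θ (-m)
  simp only [fcoeff, Complex.ofReal_add, mul_add]
  rw [intervalIntegral.integral_add, mul_add] <;>
    exact Continuous.intervalIntegrable (by fun_prop) _ _

theorem fcoeff_const_mul {θ : ℝ} (c : ℝ) (f : ℝ → ℝ) (m : ℤ) :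
    fcoeff θ (fun t => c * f t) m = c * fcoeff θ f m := by
  simp only [fcoeff, Complex.ofReal_mul, mul_left_comm _ (c : ℂ),
    intervalIntegral.integral_const_mul]

theorem fcoeff_neg {θ : ℝ} (f : ℝ → ℝ) (m : ℤ) :
    fcoeff θ (fun t => -f t) m = -fcoeff θ f m := by
  simpa using fcoeff_const_mul (θ := θ) (-1) f m

theorem fcoeff_sub {θ : ℝ} {f g : ℝ → ℝ} (hf : Continuous f) (hg : Continuous g) (m : ℤ) :
    fcoeff θ (fun t => f t - g t) m = fcoeff θ f m - fcoeff θ g m := by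
  simp only [sub_eq_add_neg, ← fcoeff_neg]
  exact fcoeff_add hf hg.neg m

theorem fcoeff_deriv {θ : ℝ} (hθ : 0 < θ) {f f' : ℝ → ℝ} (hf : ∀ t, HasDerivAt f (f' t) t)
    (hf' : Continuous f') (hp : f θ = f 0) (m : ℤ) :
    fcoeff θ f' m = Complex.I * (m * freq θ) * fcoeff θ f m := by
  have hc := continuous_character θ (-m)
  have key := intervalIntegral.integral_mul_deriv_eq_deriv_mul (a := 0) (b := θ)
    (u := character θ (-m)) (v := fun t => (f t : ℂ)) (v' := fun t => (f' t : ℂ))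
    (u' := fun t => Complex.I * ((-m : ℤ) * freq θ) * character θ (-m) t)
    (fun t _ => hasDerivAt_character θ (-m) t) (fun t _ => (hf t).ofReal_comp)
    (Continuous.intervalIntegrable (by fun_prop) _ _)
    (Continuous.intervalIntegrable (by fun_prop) _ _)
  simp only [character_period hθ, character_zero, hp, mul_assoc,
    intervalIntegral.integral_const_mul] at key
  rw [fcoeff, key, fcoeff]
  push_cast
  ring

theorem hasSum_fcoeff {θ : ℝ} (hθ : 0 < θ) {f : ℝ → ℝ} (hf : Continuous f)
    (hp : Function.Periodic f θ) (hs : Summable (fcoeff θ f)) (t : ℝ) :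
    HasSum (fun m => fcoeff θ f m * character θ m t) (f t) := by
  have : Fact (0 < θ) := ⟨hθ⟩
  have hp' : Function.Periodic (fun t => (f t : ℂ)) θ := fun t => by simp [hp t]
  let g : C(AddCircle θ, ℂ) := ⟨hp'.lift, by
    refine continuous_coinduced_dom.2 ?_
    exact Complex.continuous_ofReal.comp hf⟩
  have hg : ∀ s : ℝ, g (s : AddCircle θ) = f s := fun s => hp'.lift_coe s
  have hcoe : fourierCoeff g = fcoeff θ f := by
    ext m
    rw [fourierCoeff_eq_intervalIntegral _ _ 0, fcoeff]
    simp only [fourier_eq_character, zero_add, smul_eq_mul, Complex.real_smul, one_div,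
      Complex.ofReal_inv, hg]
  have h := has_pointwise_sum_fourier_series_of_summable (f := g) (by rwa [hcoe]) (t : AddCircle θ)
  simpa only [hcoe, fourier_eq_character, smul_eq_mul, hg] using h

theorem hasSum_sq_fcoeff {θ : ℝ} (hθ : 0 < θ) {f : ℝ → ℝ} (hf : Continuous f) :
    HasSum (fun m => ‖fcoeff θ f m‖ ^ 2) (θ⁻¹ * ∫ t in (0 : ℝ)..θ, f t ^ 2) := by
  have hL : MeasureTheory.MemLp (fun t => (f t : ℂ)) 2
      (MeasureTheory.volume.restrict (Set.Ioc 0 θ)) := by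
    obtain ⟨C, hC⟩ := (isCompact_Icc (a := 0) (b := θ)).exists_bound_of_continuousOn hf.continuousOn
    refine .of_bound (Complex.continuous_ofReal.comp hf).aestronglyMeasurable C ?_
    refine (MeasureTheory.ae_restrict_mem measurableSet_Ioc).mono fun t ht => ?_
    simpa using hC t (Set.Ioc_subset_Icc_self ht)
  have h := hasSum_sq_fourierCoeffOn hθ hL
  simpa [fcoeff_eq_fourierCoeffOn hθ] using h

theorem norm_fcoeff_sq_le {θ : ℝ} (hθ : 0 < θ) {f : ℝ → ℝ} (hf : Continuous f) (m : ℤ) :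
    ‖fcoeff θ f m‖ ^ 2 ≤ θ⁻¹ * ∫ t in (0 : ℝ)..θ, f t ^ 2 :=
  le_hasSum (hasSum_sq_fcoeff hθ hf) m fun _ _ => by positivity

/-! ### The force as an absolutely convergent Fourier series. -/

/-- Writing `|F_m| = (1/m) · (m |F_m|)` and using `ab ≤ a² + b²` splits the series into two summable
ones; the mode `m = 0` vanishes by assumption. -/
theorem IsForcing.summable_norm {F : ℤ → ℂ} (hF : IsForcing F) : Summable fun m => ‖F m‖ := by
  have h1 : Summable fun m : ℤ => 1 / |(m : ℝ)| ^ (2 : ℝ) := by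
    simpa using Real.summable_abs_int_rpow (b := 2) (by norm_num)
  refine Summable.of_nonneg_of_le (fun _ => norm_nonneg _) (fun m => ?_) (h1.add hF.summable)
  by_cases hm : m = 0
  · subst hm; simp [hF.zero]
  · have hm' : (m : ℝ) ≠ 0 := by exact_mod_cast hm
    have : (1 : ℝ) / |(m : ℝ)| ^ (2 : ℝ) = (1 / (m : ℝ)) ^ 2 := by
      rw [Real.rpow_two, sq_abs]; simp
    rw [this]
    have h2 : (1 / (m : ℝ)) * ((m : ℝ) * ‖F m‖) = ‖F m‖ := by field_simp
    nlinarith [sq_nonneg (1 / (m : ℝ) - (m : ℝ) * ‖F m‖), norm_nonneg (F m), sq_nonneg (1 / (m : ℝ)),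
      sq_nonneg ((m : ℝ) * ‖F m‖)]

theorem IsForcing.hasSum_force {F : ℤ → ℂ} (hF : IsForcing F) (θ t : ℝ) :
    HasSum (fun m => F m * character θ m t) (force θ F t) := by
  have hs : Summable fun m => F m * character θ m t :=
    Summable.of_norm (by simpa [norm_character] using hF.summable_norm)
  -- Reindexing by `m ↦ -m` shows that the sum is its own conjugate, so the real part in `force`
  -- discards nothing.
  have hreal : (starRingEnd ℂ) (∑' m, F m * character θ m t) = ∑' m, F m * character θ m t := by
    rw [Complex.conj_tsum, ← (Equiv.neg ℤ).tsum_eq (fun m => F m * character θ m t)]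
    refine tsum_congr fun m => ?_
    rw [Equiv.neg_apply, hF.conj, map_mul, character, character, ← Complex.exp_conj]
    simp
  have : ((force θ F t : ℝ) : ℂ) = ∑' m, F m * character θ m t :=
    Complex.conj_eq_iff_re.1 hreal
  rw [this]
  exact hs.hasSum

theorem IsForcing.continuous_force {F : ℤ → ℂ} (hF : IsForcing F) (θ : ℝ) :
    Continuous (force θ F) := by
  refine Complex.continuous_re.comp (continuous_tsum (fun m => ?_) hF.summable_norm fun m t => ?_)
  · exact continuous_const.mul (continuous_character θ m)
  · change ‖F m * character θ m t‖ ≤ _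
    simp [norm_character]

theorem character_periodic {θ : ℝ} (hθ : 0 < θ) (m : ℤ) : Function.Periodic (character θ m) θ := by
  intro t
  have h : character θ m (t + θ) = character θ m t * character θ m θ := by
    rw [character, character, character, ← Complex.exp_add]; congr 1; push_cast; ring
  rw [h, character_period hθ, mul_one]

theorem force_periodic {θ : ℝ} (hθ : 0 < θ) (F : ℤ → ℂ) : Function.Periodic (force θ F) θ := by
  intro t
  change (∑' m, F m * character θ m (t + θ)).re = (∑' m, F m * character θ m t).re
  simp only [character_periodic hθ _ t]

theorem integral_character {θ : ℝ} (hθ : 0 < θ) (m : ℤ) :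
    ∫ t in (0 : ℝ)..θ, character θ m t = if m = 0 then (θ : ℂ) else 0 := by
  split_ifs with hm
  · subst hm; simp [character]
  · have hc := continuous_character θ m
    have hn : Complex.I * (m * freq θ) ≠ 0 := by
      have : freq θ ≠ 0 := by rw [freq]; positivity
      simp [hm, this]
    have h := intervalIntegral.integral_eq_sub_of_hasDerivAt (a := 0) (b := θ)
      (fun t _ => hasDerivAt_character θ m t) (Continuous.intervalIntegrable (by fun_prop) _ _)
    rw [intervalIntegral.integral_const_mul, character_period hθ, character_zero, sub_self] at h
    exact (mul_eq_zero.1 h).resolve_left hn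

theorem IsForcing.fcoeff_force {θ : ℝ} (hθ : 0 < θ) {F : ℤ → ℂ} (hF : IsForcing F) (m : ℤ) :
    fcoeff θ (force θ F) m = F m := by
  have hmul : ∀ k t, character θ (-m) t * (F k * character θ k t) = F k * character θ (k - m) t := by
    intro k t
    rw [mul_left_comm]
    congr 1
    rw [character, character, character, ← Complex.exp_add]; congr 1; push_cast; ring
  have h := intervalIntegral.hasSum_integral_of_dominated_convergence
    (μ := MeasureTheory.volume) (a := 0) (b := θ)
    (F := fun k t => character θ (-m) t * (F k * character θ k t))
    (f := fun t => character θ (-m) t * (force θ F t : ℂ))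
    (fun k _ => ‖F k‖)
    (fun k => by
      have h1 := continuous_character θ (-m)
      have h2 := continuous_character θ k
      exact Continuous.aestronglyMeasurable (by fun_prop))
    (fun k => Filter.Eventually.of_forall fun t _ => by simp [norm_character])
    (Filter.Eventually.of_forall fun t _ => hF.summable_norm)
    (Continuous.intervalIntegrable continuous_const _ _)
    (Filter.Eventually.of_forall fun t _ => (hF.hasSum_force θ t).mul_left _)
  simp only [hmul, intervalIntegral.integral_const_mul, integral_character hθ, sub_eq_zero] at h
  have hite : (fun k => F k * if k = m then (θ : ℂ) else 0)
      = fun k => if k = m then F m * θ else 0 := by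
    ext k; split_ifs with hk <;> simp [hk]
  rw [hite] at h
  have h' := (hasSum_ite_eq m (F m * θ)).unique h
  rw [fcoeff, ← h']
  have h0 : (θ : ℂ) ≠ 0 := by exact_mod_cast hθ.ne'
  field_simp

/-! ### Weighted norms and the Neumann Laplacian. -/

/-- The square of the weighted `ℓ²` norm of `f`. -/
noncomputable def wsum {N : ℕ} (w : ℤ → ℝ) (f : Site N → ℝ) : ℝ := ∑ x : Site N, w x ^ 2 * f x ^ 2

/-- Positive weights whose logarithm varies slowly: `w_x / w_{x+1} + w_{x+1} / w_x ≤ 2 + κ`. -/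
structure IsWeight (κ : ℝ) (w : ℤ → ℝ) : Prop where
  pos : ∀ x, 0 < w x
  slow : ∀ x, w x ^ 2 + w (x + 1) ^ 2 ≤ (2 + κ) * (w x * w (x + 1))

theorem wsum_nonneg {N : ℕ} (w : ℤ → ℝ) (f : Site N → ℝ) : 0 ≤ wsum w f :=
  Finset.sum_nonneg fun _ _ => by positivity

theorem sum_site (N : ℕ) (G : ℤ → ℝ) :
    ∑ x : Site N, G x = ∑ i ∈ Finset.range (2 * N + 1), G (-N + i) := by
  refine Finset.sum_bij' (fun x _ => (x.1 + N).toNat)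
    (fun i hi => ⟨-N + i, by rw [Finset.mem_range] at hi; constructor <;> omega⟩) ?_ ?_ ?_ ?_ ?_
  · rintro ⟨x, hx⟩ _
    have := hx.1; have := hx.2
    simp only [Finset.mem_range]; omega
  · intros; exact Finset.mem_univ _
  · rintro ⟨x, hx⟩ _
    have := hx.1
    refine Subtype.ext ?_
    change -(N : ℤ) + ((x + N).toNat : ℤ) = x
    omega
  · intro i _; simp
  · rintro ⟨x, hx⟩ _
    have := hx.1
    congr 1; simp only; omega

theorem ext_coe {N : ℕ} (f : Site N → ℝ) (x : Site N) : ext f x = f x :=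
  Set.IccExtend_val _ _ _

theorem ext_right {N : ℕ} (f : Site N → ℝ) : ext f (N + 1) = ext f N := by
  rw [ext, Set.IccExtend_of_right_le _ _ (by omega), Set.IccExtend_of_right_le _ _ le_rfl]

theorem ext_left {N : ℕ} (f : Site N → ℝ) : ext f (-N - 1) = ext f (-N) := by
  rw [ext, Set.IccExtend_of_le_left _ _ (by omega), Set.IccExtend_of_le_left _ _ le_rfl]

theorem ext_sub {N : ℕ} (f g : Site N → ℝ) (x : ℤ) :
    ext (fun y => f y - g y) x = ext f x - ext g x := rfl

theorem ext_add {N : ℕ} (f g : Site N → ℝ) (x : ℤ) :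
    ext (fun y => f y + g y) x = ext f x + ext g x := rfl

theorem wsum_eq_range {N : ℕ} (w : ℤ → ℝ) (f : Site N → ℝ) :
    wsum w f = ∑ i ∈ Finset.range (2 * N + 1), w (-N + i) ^ 2 * ext f (-N + i) ^ 2 := by
  rw [← sum_site N fun x => w x ^ 2 * ext f x ^ 2]
  simp only [ext_coe, wsum]

theorem sum_range_head_le_wsum {N : ℕ} (w : ℤ → ℝ) (f : Site N → ℝ) :
    ∑ i ∈ Finset.range (2 * N), w (-N + i) ^ 2 * ext f (-N + i) ^ 2 ≤ wsum w f := by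
  rw [wsum_eq_range, Finset.sum_range_succ]
  exact le_add_of_nonneg_right (by positivity)

theorem sum_range_tail_le_wsum {N : ℕ} (w : ℤ → ℝ) (f : Site N → ℝ) :
    ∑ i ∈ Finset.range (2 * N), w (-N + i + 1) ^ 2 * ext f (-N + i + 1) ^ 2 ≤ wsum w f := by
  rw [wsum_eq_range, Finset.sum_range_succ']
  simp only [Nat.cast_add, Nat.cast_one, add_assoc]
  exact le_add_of_nonneg_right (by positivity)

theorem sum_by_parts (f φ : ℤ → ℝ) (b : ℤ) (n : ℕ) :
    ∑ i ∈ Finset.range n, φ (b + i) * (f (b + i + 1) + f (b + i - 1) - 2 * f (b + i))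
      = φ (b + n - 1) * (f (b + n) - f (b + n - 1)) - φ (b - 1) * (f b - f (b - 1))
        - ∑ i ∈ Finset.range n, (φ (b + i) - φ (b + i - 1)) * (f (b + i) - f (b + i - 1)) := by
  induction n with
  | zero => simp
  | succ n ih =>
    rw [Finset.sum_range_succ, Finset.sum_range_succ, ih]
    push_cast
    rw [show b + ((n : ℤ) + 1) - 1 = b + n by ring, ← add_assoc]
    ring

/-- Summation by parts; the Neumann condition kills both boundary terms, leaving the `2N` interior
bonds. -/
theorem sum_mul_lap {N : ℕ} (φ : ℤ → ℝ) (f : Site N → ℝ) :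
    ∑ x : Site N, φ x * lap f x = -∑ i ∈ Finset.range (2 * N),
      (φ (-N + i + 1) - φ (-N + i)) * (ext f (-N + i + 1) - ext f (-N + i)) := by
  have h := sum_site N fun x => φ x * (ext f (x + 1) + ext f (x - 1) - 2 * ext f x)
  simp only [ext_coe] at h
  simp only [lap]
  rw [h, sum_by_parts, Finset.sum_range_succ']
  have e1 : -(N : ℤ) + ((2 * N + 1 : ℕ) : ℤ) = N + 1 := by push_cast; ring
  rw [e1, ext_right]
  simp only [Nat.cast_add, Nat.cast_one, Nat.cast_zero, add_zero, ext_left, add_sub_cancel_right,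
    sub_self, mul_zero, zero_sub, ← add_assoc]

/-- Slow variation replaces `v² + w²` by `(2 + κ) v w` in the cross term, and AM-GM then bounds it
by `1 + κ/2` times the diagonal part. Each site meets at most two bonds, so summing over bonds gives
the spectral window `[-κ, 4 + κ]`. -/
theorem bond_bounds {κ v w a b : ℝ} (hv : 0 < v) (hw : 0 < w)
    (h : v ^ 2 + w ^ 2 ≤ (2 + κ) * (v * w)) :
    -(κ / 2) * (v ^ 2 * a ^ 2 + w ^ 2 * b ^ 2) ≤ (w ^ 2 * b - v ^ 2 * a) * (b - a) ∧
    (w ^ 2 * b - v ^ 2 * a) * (b - a) ≤ (2 + κ / 2) * (v ^ 2 * a ^ 2 + w ^ 2 * b ^ 2) := by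
  have e : (w ^ 2 * b - v ^ 2 * a) * (b - a)
      = v ^ 2 * a ^ 2 + w ^ 2 * b ^ 2 - (v ^ 2 + w ^ 2) * (a * b) := by ring
  have hab : |(v ^ 2 + w ^ 2) * (a * b)| ≤ (1 + κ / 2) * (v ^ 2 * a ^ 2 + w ^ 2 * b ^ 2) := by
    have hκ : 0 ≤ 2 + κ := by
      have : 0 < v * w := by positivity
      by_contra! hneg
      nlinarith [sq_nonneg v, sq_nonneg w]
    rw [abs_mul, abs_of_nonneg (by positivity : 0 ≤ v ^ 2 + w ^ 2)]
    calc (v ^ 2 + w ^ 2) * |a * b| ≤ (2 + κ) * (v * w) * |a * b| := by gcongr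
      _ = (2 + κ) * ((v * |a|) * (w * |b|)) := by rw [abs_mul]; ring
      _ ≤ (2 + κ) * (((v * |a|) ^ 2 + (w * |b|) ^ 2) / 2) := by
        gcongr; nlinarith [sq_nonneg (v * |a| - w * |b|)]
      _ = _ := by rw [mul_pow, mul_pow, sq_abs, sq_abs]; ring
  have := abs_le.1 hab
  rw [e]
  constructor <;> linarith [this.1, this.2]

theorem IsWeight.lap_bounds {κ : ℝ} {w : ℤ → ℝ} (hw : IsWeight κ w) (hκ : 0 ≤ κ) {N : ℕ}
    (f : Site N → ℝ) :
    -κ * wsum w f ≤ -∑ x : Site N, w x ^ 2 * f x * lap f x ∧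
    -∑ x : Site N, w x ^ 2 * f x * lap f x ≤ (4 + κ) * wsum w f := by
  have h := sum_mul_lap (fun x => w x ^ 2 * ext f x) f
  simp only [ext_coe] at h
  have h1 := sum_range_head_le_wsum w f
  have h2 := sum_range_tail_le_wsum w f
  have hb := fun i : ℕ => bond_bounds (a := ext f (-N + i)) (b := ext f (-N + i + 1))
    (hw.pos (-N + i)) (hw.pos (-N + i + 1)) (hw.slow (-N + i))
  rw [h, neg_neg]
  constructor
  · refine le_trans ?_ (Finset.sum_le_sum fun i _ => (hb i).1)
    rw [← Finset.mul_sum, Finset.sum_add_distrib]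
    nlinarith
  · refine (Finset.sum_le_sum fun i _ => (hb i).2).trans ?_
    rw [← Finset.mul_sum, Finset.sum_add_distrib]
    nlinarith

theorem IsWeight.le_three_mul {κ : ℝ} {w : ℤ → ℝ} (hw : IsWeight κ w) (hκ : κ ≤ 1) (x : ℤ) :
    w x ≤ 3 * w (x + 1) ∧ w (x + 1) ≤ 3 * w x := by
  have h1 := hw.pos x
  have h2 := hw.pos (x + 1)
  have h3 := hw.slow x
  have h4 : (2 + κ) * (w x * w (x + 1)) ≤ 3 * (w x * w (x + 1)) := by gcongr; linarith
  constructor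
  · refine le_of_mul_le_mul_left ?_ h1; nlinarith
  · refine le_of_mul_le_mul_left ?_ h2; nlinarith

/-- Neighbouring weights differ by a factor of at most `3`, which costs `9` after squaring; one more
unit pays for the endpoint, whose value the Neumann extension repeats. -/
theorem IsWeight.sum_shift_right_le {κ : ℝ} {w : ℤ → ℝ} (hw : IsWeight κ w) (hκ : κ ≤ 1) {N : ℕ}
    (f : Site N → ℝ) : ∑ x : Site N, w x ^ 2 * ext f (x + 1) ^ 2 ≤ 10 * wsum w f := by
  rw [sum_site N fun x => w x ^ 2 * ext f (x + 1) ^ 2, Finset.sum_range_succ]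
  have e : -(N : ℤ) + ((2 * N : ℕ) : ℤ) = N := by push_cast; ring
  have hN : w N ^ 2 * ext f N ^ 2 ≤ wsum w f := by
    rw [wsum_eq_range, Finset.sum_range_succ, e]
    exact le_add_of_nonneg_left (Finset.sum_nonneg fun _ _ => by positivity)
  have h2 := sum_range_tail_le_wsum w f
  have h : ∑ i ∈ Finset.range (2 * N), w (-N + i) ^ 2 * ext f (-N + i + 1) ^ 2
      ≤ ∑ i ∈ Finset.range (2 * N), 9 * (w (-N + i + 1) ^ 2 * ext f (-N + i + 1) ^ 2) := by
    refine Finset.sum_le_sum fun i _ => ?_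
    rw [← mul_assoc]
    gcongr
    have := pow_le_pow_left₀ (hw.pos _).le (hw.le_three_mul hκ (-N + i)).1 2
    linarith
  rw [← Finset.mul_sum] at h
  rw [e, ext_right]
  linarith

theorem IsWeight.sum_shift_left_le {κ : ℝ} {w : ℤ → ℝ} (hw : IsWeight κ w) (hκ : κ ≤ 1) {N : ℕ}
    (f : Site N → ℝ) : ∑ x : Site N, w x ^ 2 * ext f (x - 1) ^ 2 ≤ 10 * wsum w f := by
  rw [sum_site N fun x => w x ^ 2 * ext f (x - 1) ^ 2, Finset.sum_range_succ']
  have hN : w (-N) ^ 2 * ext f (-N) ^ 2 ≤ wsum w f := by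
    rw [wsum_eq_range, Finset.sum_range_succ']
    simp only [Nat.cast_zero, add_zero]
    exact le_add_of_nonneg_left (Finset.sum_nonneg fun _ _ => by positivity)
  have h2 := sum_range_head_le_wsum w f
  have h : ∑ i ∈ Finset.range (2 * N), w (-N + i + 1) ^ 2 * ext f (-N + i) ^ 2
      ≤ ∑ i ∈ Finset.range (2 * N), 9 * (w (-N + i) ^ 2 * ext f (-N + i) ^ 2) := by
    refine Finset.sum_le_sum fun i _ => ?_
    rw [← mul_assoc]
    gcongr
    have := pow_le_pow_left₀ (hw.pos _).le (hw.le_three_mul hκ (-N + i)).2 2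
    linarith
  rw [← Finset.mul_sum] at h
  simp only [Nat.cast_zero, add_zero, ext_left, Nat.cast_add, Nat.cast_one, ← add_assoc,
    add_sub_cancel_right]
  linarith

/-! ### Lipschitz bounds for the anharmonic term. -/

theorem IsPotential.lipschitz {G : ℝ → ℝ} (hG : IsPotential G) (a b : ℝ) :
    |deriv G a - deriv G b| ≤ supSecond G * |a - b| := by
  have hd : Differentiable ℝ (deriv G) :=
    (ContDiff.deriv' (n := 1) hG.contDiff).differentiable (by norm_num)
  have := Convex.norm_image_sub_le_of_norm_deriv_le (f := deriv G) (C := supSecond G)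
    (s := Set.univ) (x := b) (y := a) (fun x _ => hd x) (fun x _ => le_ciSup hG.bounded x)
    convex_univ (Set.mem_univ _) (Set.mem_univ _)
  simpa using this

theorem IsPotential.continuous_deriv {G : ℝ → ℝ} (hG : IsPotential G) : Continuous (deriv G) :=
  hG.contDiff.continuous_deriv (by norm_num)

theorem supSecond_nonneg (G : ℝ → ℝ) : 0 ≤ supSecond G :=
  Real.iSup_nonneg fun _ => abs_nonneg _

/-- The coefficient is `‖V''‖ + 2‖U''‖` at `x` and `‖U''‖` at each neighbour, all at most `𝔙`. -/
theorem anharm_lipschitz {V U : ℝ → ℝ} (hV : IsPotential V) (hU : IsPotential U) {K : ℝ}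
    (hK : frakV V U ≤ K) {N : ℕ} (f g : Site N → ℝ) (x : Site N) :
    |anharm V U f x - anharm V U g x| ≤
      K * (|f x - g x| + |ext (fun y => f y - g y) (x + 1)| + |ext (fun y => f y - g y) (x - 1)|) := by
  have hv := supSecond_nonneg V
  have hu := supSecond_nonneg U
  rw [frakV] at hK
  have h1 := hV.lipschitz (f x) (g x)
  have h2 := hU.lipschitz (ext f (x + 1) - ext f x) (ext g (x + 1) - ext g x)
  have h3 := hU.lipschitz (ext f x - ext f (x - 1)) (ext g x - ext g (x - 1))
  simp only [ext_coe] at h2 h3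
  simp only [anharm, grad, ext_sub, add_sub_cancel_right, ext_coe]
  set a := f x - g x
  set b := ext f (x + 1) - ext g (x + 1)
  set c := ext f (x - 1) - ext g (x - 1)
  have h2' : |ext f (x + 1) - f x - (ext g (x + 1) - g x)| ≤ |b| + |a| := by
    rw [show ext f (x + 1) - f x - (ext g (x + 1) - g x) = b - a by ring]; exact abs_sub _ _
  have h3' : |f x - ext f (x - 1) - (g x - ext g (x - 1))| ≤ |a| + |c| := by
    rw [show f x - ext f (x - 1) - (g x - ext g (x - 1)) = a - c by ring]; exact abs_sub _ _
  have h2'' := h2.trans (mul_le_mul_of_nonneg_left h2' hu)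
  have h3'' := h3.trans (mul_le_mul_of_nonneg_left h3' hu)
  have ha := mul_le_mul_of_nonneg_right hK (abs_nonneg a)
  have hb := mul_le_mul_of_nonneg_right hK (abs_nonneg b)
  have hc := mul_le_mul_of_nonneg_right hK (abs_nonneg c)
  have := abs_nonneg a
  have := abs_nonneg b
  have := abs_nonneg c
  rw [abs_le] at h1 h2'' h3'' ⊢
  constructor <;> nlinarith [h1.1, h1.2, h2''.1, h2''.2, h3''.1, h3''.2, mul_nonneg hv (abs_nonneg b),
    mul_nonneg hv (abs_nonneg c), mul_nonneg hu (abs_nonneg a), mul_nonneg hu (abs_nonneg b),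
    mul_nonneg hu (abs_nonneg c)]

theorem anharm_zero {V U : ℝ → ℝ} (hV : deriv V 0 = 0) {N : ℕ} (x : Site N) :
    anharm V U (fun _ => 0) x = 0 := by
  have : ∀ y, ext (fun _ : Site N => (0 : ℝ)) y = 0 := fun _ => rfl
  simp [anharm, grad, this, hV]

/-- The constant is `63 = 3 (1 + 10 + 10)`: `3` from squaring a sum of three terms, `10` from each
shift. -/
theorem IsWeight.wsum_anharm_sub_le {κ : ℝ} {w : ℤ → ℝ} (hw : IsWeight κ w) (hκ : κ ≤ 1)
    {V U : ℝ → ℝ} (hV : IsPotential V) (hU : IsPotential U) {K : ℝ}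
    (hK : frakV V U ≤ K) {N : ℕ} (f g : Site N → ℝ) :
    wsum w (fun x => anharm V U f x - anharm V U g x) ≤ 63 * K ^ 2 * wsum w (fun x => f x - g x) := by
  have h1 := hw.sum_shift_right_le hκ (fun x => f x - g x)
  have h2 := hw.sum_shift_left_le hκ (fun x => f x - g x)
  have hx : ∀ x : Site N, w x ^ 2 * (anharm V U f x - anharm V U g x) ^ 2 ≤
      3 * K ^ 2 * (w x ^ 2 * (f x - g x) ^ 2 + w x ^ 2 * ext (fun y => f y - g y) (x + 1) ^ 2
        + w x ^ 2 * ext (fun y => f y - g y) (x - 1) ^ 2) := by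
    intro x
    have h := pow_le_pow_left₀ (abs_nonneg _) (anharm_lipschitz hV hU hK f g x) 2
    rw [sq_abs, mul_pow] at h
    have h' : (|f x - g x| + |ext (fun y => f y - g y) (x + 1)| + |ext (fun y => f y - g y) (x - 1)|) ^ 2
        ≤ 3 * ((f x - g x) ^ 2 + ext (fun y => f y - g y) (x + 1) ^ 2
          + ext (fun y => f y - g y) (x - 1) ^ 2) := by
      rw [← sq_abs (f x - g x), ← sq_abs (ext _ ((x : ℤ) + 1)), ← sq_abs (ext _ ((x : ℤ) - 1))]
      set a := |f x - g x|
      set b := |ext (fun y => f y - g y) (x + 1)|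
      set c := |ext (fun y => f y - g y) (x - 1)|
      nlinarith [sq_nonneg (a - b), sq_nonneg (b - c), sq_nonneg (a - c)]
    have h3 := mul_le_mul_of_nonneg_left (h.trans (mul_le_mul_of_nonneg_left h' (sq_nonneg K)))
      (sq_nonneg (w x))
    linarith
  refine (Finset.sum_le_sum fun x _ => hx x).trans ?_
  rw [← Finset.mul_sum, Finset.sum_add_distrib, Finset.sum_add_distrib]
  change 3 * K ^ 2 * (wsum w (fun x => f x - g x) + _ + _) ≤ _
  nlinarith [sq_nonneg K]

theorem wsum_add_le {N : ℕ} (w : ℤ → ℝ) (f g : Site N → ℝ) :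
    wsum w (fun x => f x + g x) ≤ 2 * wsum w f + 2 * wsum w g := by
  simp only [wsum, Finset.mul_sum, ← Finset.sum_add_distrib]
  refine Finset.sum_le_sum fun x _ => ?_
  nlinarith [sq_nonneg (w x * f x - w x * g x)]

theorem wsum_const_mul {N : ℕ} (w : ℤ → ℝ) (c : ℝ) (f : Site N → ℝ) :
    wsum w (fun x => c * f x) = c ^ 2 * wsum w f := by
  simp only [wsum, Finset.mul_sum]
  exact Finset.sum_congr rfl fun x _ => by ring

theorem sq_le_wsum {N : ℕ} (w : ℤ → ℝ) (f : Site N → ℝ) (x : Site N) :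
    w x ^ 2 * f x ^ 2 ≤ wsum w f :=
  Finset.single_le_sum (f := fun x : Site N => w x ^ 2 * f x ^ 2) (fun _ _ => by positivity)
    (Finset.mem_univ x)

/-! ### The harmonic chain, mode by mode. -/

/-- `q` is a `θ`-periodic solution of the harmonic chain driven by `g`. -/
structure IsLinearSolution (ω₀ γ θ : ℝ) {N : ℕ} (g q : Site N → ℝ → ℝ) : Prop where
  differentiable : ∀ x, Differentiable ℝ (q x)
  equation : ∀ x, ∀ t : ℝ, HasDerivAt (deriv (q x))
    (lap (fun y => q y t) x - ω₀ ^ 2 * q x t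
      - γ * (delta (-(N : ℤ)) x + delta (N : ℤ) x) * deriv (q x) t + g x t) t
  periodic : ∀ x, Function.Periodic (q x) θ

/-- The frequencies `m ω` keep away from the band `[ω₀, √(ω₀² + 4)]`. -/
def SpectralGap (ω₀ θ c : ℝ) : Prop :=
  ∀ m : ℤ, c * (1 + (m * freq θ) ^ 2) ≤ ω₀ ^ 2 - (m * freq θ) ^ 2 ∨
    c * (1 + (m * freq θ) ^ 2) ≤ (m * freq θ) ^ 2 - ω₀ ^ 2 - 4

/-- The square of the weighted `ℓ²` norm of a complex vector. -/
noncomputable def csum {N : ℕ} (w : ℤ → ℝ) (z : Site N → ℂ) : ℝ :=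
  ∑ x : Site N, w x ^ 2 * ‖z x‖ ^ 2

theorem csum_eq {N : ℕ} (w : ℤ → ℝ) (z : Site N → ℂ) :
    csum w z = wsum w (fun x => (z x).re) + wsum w fun x => (z x).im := by
  simp only [csum, wsum, ← Finset.sum_add_distrib]
  refine Finset.sum_congr rfl fun x _ => ?_
  rw [← Complex.normSq_eq_norm_sq, Complex.normSq_apply]; ring

theorem sq_le_csum {N : ℕ} (w : ℤ → ℝ) (z : Site N → ℂ) (x : Site N) :
    w x ^ 2 * ‖z x‖ ^ 2 ≤ csum w z :=
  Finset.single_le_sum (f := fun x : Site N => w x ^ 2 * ‖z x‖ ^ 2) (fun _ _ => by positivity)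
    (Finset.mem_univ x)

theorem csum_nonneg {N : ℕ} (w : ℤ → ℝ) (z : Site N → ℂ) : 0 ≤ csum w z :=
  Finset.sum_nonneg fun _ _ => by positivity

theorem csum_add_le {N : ℕ} (w : ℤ → ℝ) (y z : Site N → ℂ) :
    csum w (fun x => y x + z x) ≤ 2 * csum w y + 2 * csum w z := by
  have h1 := wsum_add_le w (fun x => (y x).re) fun x => (z x).re
  have h2 := wsum_add_le w (fun x => (y x).im) fun x => (z x).im
  simp only [csum_eq, Complex.add_re, Complex.add_im]
  linarith

/-- Multiply by `w² z̄` and take the real part: the terms in `b` cancel. The gap `c` loses `κ ≤ c/2`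
to the weight and `c/4` to Young's inequality, leaving `c/4`. Below the band the lower bound on the
Laplacian is used, above it the upper bound. -/
theorem coercive_estimate {ω₀ κ c lam : ℝ} {w : ℤ → ℝ} (hw : IsWeight κ w) (hκ : 0 ≤ κ)
    (hc : 0 < c) (hκc : κ ≤ c / 2)
    (hgap : c ≤ ω₀ ^ 2 - lam ∨ c ≤ lam - ω₀ ^ 2 - 4)
    {N : ℕ} (b : Site N → ℝ) (z g : Site N → ℂ)
    (hre : ∀ x, -lam * (z x).re = lap (fun y => (z y).re) x - ω₀ ^ 2 * (z x).re
      + b x * (z x).im + (g x).re)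
    (him : ∀ x, -lam * (z x).im = lap (fun y => (z y).im) x - ω₀ ^ 2 * (z x).im
      - b x * (z x).re + (g x).im) :
    csum w z ≤ 4 * csum w g / c ^ 2 := by
  have h1 := hw.lap_bounds hκ fun y : Site N => (z y).re
  have h2 := hw.lap_bounds hκ fun y : Site N => (z y).im
  have hid : (ω₀ ^ 2 - lam) * csum w z
      - ∑ x : Site N, w x ^ 2 * (z x).re * lap (fun y => (z y).re) x
      - ∑ x : Site N, w x ^ 2 * (z x).im * lap (fun y => (z y).im) x
      = ∑ x : Site N, w x ^ 2 * ((z x).re * (g x).re + (z x).im * (g x).im) := by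
    rw [csum_eq, wsum, wsum, ← Finset.sum_add_distrib, Finset.mul_sum, ← Finset.sum_sub_distrib,
      ← Finset.sum_sub_distrib]
    refine Finset.sum_congr rfl fun x _ => ?_
    linear_combination (w x ^ 2 * (z x).re) * hre x + (w x ^ 2 * (z x).im) * him x
  have hR : |∑ x : Site N, w x ^ 2 * ((z x).re * (g x).re + (z x).im * (g x).im)|
      ≤ c / 4 * csum w z + csum w g / c := by
    refine (Finset.abs_sum_le_sum_abs _ _).trans ?_
    rw [csum, csum, Finset.mul_sum, Finset.sum_div, ← Finset.sum_add_distrib]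
    refine Finset.sum_le_sum fun x _ => ?_
    have hprod : |(z x).re * (g x).re + (z x).im * (g x).im| ≤ ‖z x‖ * ‖g x‖ := by
      have h := Complex.abs_re_le_norm (z x * (starRingEnd ℂ) (g x))
      rw [norm_mul, Complex.norm_conj, Complex.mul_re, Complex.conj_re, Complex.conj_im] at h
      simpa using h
    have hyoung : ‖z x‖ * ‖g x‖ ≤ c / 4 * ‖z x‖ ^ 2 + ‖g x‖ ^ 2 / c := by
      have e : c / 4 * ‖z x‖ ^ 2 + ‖g x‖ ^ 2 / c - ‖z x‖ * ‖g x‖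
          = (c / 2 * ‖z x‖ - ‖g x‖) ^ 2 / c := by field_simp; ring
      have : 0 ≤ (c / 2 * ‖z x‖ - ‖g x‖) ^ 2 / c := by positivity
      linarith
    rw [abs_mul, abs_of_nonneg (sq_nonneg (w x))]
    have := mul_le_mul_of_nonneg_left (hprod.trans hyoung) (sq_nonneg (w x))
    calc _ ≤ _ := this
      _ = _ := by ring
  have hS := csum_nonneg w z
  have hS' := csum_eq w z
  have hmain : c / 4 * csum w z ≤ csum w g / c := by
    rw [← hid, abs_le] at hR
    rcases hgap with h | h
    · have := mul_le_mul_of_nonneg_right h hS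
      have := mul_le_mul_of_nonneg_right hκc hS
      nlinarith [hR.2, h1.1, h2.1]
    · have := mul_le_mul_of_nonneg_right h hS
      have := mul_le_mul_of_nonneg_right hκc hS
      nlinarith [hR.1, h1.2, h2.2]
  rw [le_div_iff₀ (by positivity)]
  rw [le_div_iff₀ hc] at hmain
  linarith

theorem continuous_lap {N : ℕ} {q : Site N → ℝ → ℝ} (hq : ∀ x, Continuous (q x)) (x : Site N) :
    Continuous fun t => lap (fun y => q y t) x := by
  have h : ∀ z, Continuous fun t => ext (fun y => q y t) z := fun z => hq _
  exact ((h _).add (h _)).sub (continuous_const.mul (hq x))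

theorem fcoeff_lap {θ : ℝ} {N : ℕ} {q : Site N → ℝ → ℝ} (hq : ∀ x, Continuous (q x)) (m : ℤ)
    (x : Site N) :
    (fcoeff θ (fun t => lap (fun y => q y t) x) m).re = lap (fun y => (fcoeff θ (q y) m).re) x ∧
    (fcoeff θ (fun t => lap (fun y => q y t) x) m).im = lap (fun y => (fcoeff θ (q y) m).im) x := by
  have h : ∀ z, Continuous fun t => ext (fun y => q y t) z := fun z => hq _
  have e : fcoeff θ (fun t => lap (fun y => q y t) x) m =
      fcoeff θ (fun t => ext (fun y => q y t) (x + 1)) m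
        + fcoeff θ (fun t => ext (fun y => q y t) (x - 1)) m - (2 : ℝ) * fcoeff θ (q x) m := by
    rw [← fcoeff_add (h _) (h _), ← fcoeff_const_mul]
    exact fcoeff_sub ((h _).add (h _)) (continuous_const.mul (hq x)) m
  rw [e]
  constructor
  · rw [Complex.sub_re, Complex.add_re, Complex.re_ofReal_mul]; rfl
  · rw [Complex.sub_im, Complex.add_im, Complex.im_ofReal_mul]; rfl

namespace IsLinearSolution

variable {ω₀ γ θ : ℝ} {N : ℕ} {g q : Site N → ℝ → ℝ}

theorem continuous (h : IsLinearSolution ω₀ γ θ g q) (x : Site N) : Continuous (q x) :=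
  (h.differentiable x).continuous

theorem continuous_deriv (h : IsLinearSolution ω₀ γ θ g q) (x : Site N) :
    Continuous (deriv (q x)) :=
  continuous_iff_continuousAt.2 fun t => (h.equation x t).continuousAt

theorem deriv_period (h : IsLinearSolution ω₀ γ θ g q) (x : Site N) :
    deriv (q x) θ = deriv (q x) 0 := by
  have h1 := deriv_comp_add_const (q x) θ 0
  rw [show (fun t => q x (t + θ)) = q x from funext (h.periodic x), zero_add] at h1
  exact h1.symm

theorem fcoeff_deriv (h : IsLinearSolution ω₀ γ θ g q) (hθ : 0 < θ) (x : Site N) (m : ℤ) :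
    fcoeff θ (deriv (q x)) m = Complex.I * (m * freq θ) * fcoeff θ (q x) m :=
  ForcedChain.fcoeff_deriv hθ (fun t => (h.differentiable x t).hasDerivAt) (h.continuous_deriv x)
    (by simpa using h.periodic x 0) m

/-- Periodicity of both `q` and its derivative lets one integrate by parts twice, turning the second
derivative into `-(mω)²`. -/
theorem fcoeff_equation (h : IsLinearSolution ω₀ γ θ g q) (hθ : 0 < θ)
    (hg : ∀ x, Continuous (g x)) (x : Site N) (m : ℤ) :
    -((m * freq θ) ^ 2 : ℝ) * fcoeff θ (q x) m = fcoeff θ (fun t => lap (fun y => q y t) x) m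
      - (ω₀ ^ 2 : ℝ) * fcoeff θ (q x) m
      - (γ * (delta (-(N : ℤ)) x + delta (N : ℤ) x) : ℝ) *
        (Complex.I * (m * freq θ) * fcoeff θ (q x) m) + fcoeff θ (g x) m := by
  have hl := continuous_lap h.continuous x
  have hq := h.continuous x
  have hp := h.continuous_deriv x
  have hgx := hg x
  have e := ForcedChain.fcoeff_deriv hθ (h.equation x) (by fun_prop) (h.deriv_period x) m
  rw [fcoeff_add (by fun_prop) (by fun_prop), fcoeff_sub (by fun_prop) (by fun_prop),
    fcoeff_sub (by fun_prop) (by fun_prop), fcoeff_const_mul, fcoeff_const_mul,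
    h.fcoeff_deriv hθ] at e
  rw [e]
  push_cast
  linear_combination (-((m : ℂ) * freq θ) ^ 2 * fcoeff θ (q x) m) * Complex.I_sq

theorem csum_fcoeff_le (h : IsLinearSolution ω₀ γ θ g q) (hθ : 0 < θ)
    (hg : ∀ x, Continuous (g x)) {κ c : ℝ} {w : ℤ → ℝ} (hw : IsWeight κ w) (hκ : 0 ≤ κ)
    (hc : 0 < c) (hκc : κ ≤ c / 2) (hgap : SpectralGap ω₀ θ c) (m : ℤ) :
    csum w (fun x => fcoeff θ (q x) m) ≤
      4 * csum w (fun x => fcoeff θ (g x) m) / (c * (1 + (m * freq θ) ^ 2)) ^ 2 := by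
  -- The gap of each mode is at least `c`, so a single weight with `κ ≤ c/2` serves all modes.
  have h1 : c ≤ c * (1 + (m * freq θ) ^ 2) :=
    le_mul_of_one_le_right hc.le (by nlinarith [sq_nonneg (m * freq θ)])
  refine coercive_estimate hw hκ (hc.trans_le h1) (by linarith) (hgap m)
    (fun x => γ * (delta (-(N : ℤ)) x + delta (N : ℤ) x) * (m * freq θ)) _ _ (fun x => ?_)
    fun x => ?_
  · have e := congrArg Complex.re (h.fcoeff_equation hθ hg x m)
    rw [Complex.add_re, Complex.sub_re, Complex.sub_re, ← Complex.ofReal_neg,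
      Complex.re_ofReal_mul, Complex.re_ofReal_mul, Complex.re_ofReal_mul,
      (fcoeff_lap h.continuous m x).1] at e
    rw [e]
    simp
    ring
  · have e := congrArg Complex.im (h.fcoeff_equation hθ hg x m)
    rw [Complex.add_im, Complex.sub_im, Complex.sub_im, ← Complex.ofReal_neg,
      Complex.im_ofReal_mul, Complex.im_ofReal_mul, Complex.im_ofReal_mul,
      (fcoeff_lap h.continuous m x).2] at e
    rw [e]
    simp
    ring

end IsLinearSolution

/-! ### Summation over modes: amplitude and kinetic energy. -/

/-- The sum of `1 / (1 + (m ω)²)` over all harmonics. -/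
noncomputable def resolventSum (θ : ℝ) : ℝ := ∑' m : ℤ, (1 + (m * freq θ) ^ 2)⁻¹

theorem summable_resolvent {θ : ℝ} (hθ : 0 < θ) :
    Summable fun m : ℤ => (1 + (m * freq θ) ^ 2)⁻¹ := by
  have hf : 0 < freq θ := by rw [freq]; positivity
  have h1 : Summable fun m : ℤ => ((m : ℝ) ^ 2)⁻¹ * (freq θ ^ 2)⁻¹ := by
    refine Summable.mul_right _ ?_
    simpa using Real.summable_one_div_int_pow (p := 2).2 (by norm_num)
  refine Summable.of_norm_bounded_eventually h1 ?_
  have : {m : ℤ | ¬ ‖(1 + (m * freq θ) ^ 2)⁻¹‖ ≤ ((m : ℝ) ^ 2)⁻¹ * (freq θ ^ 2)⁻¹} ⊆ {0} := by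
    intro m hm
    by_contra h0
    refine hm ?_
    have hm' : (m : ℝ) ≠ 0 := by exact_mod_cast h0
    rw [Real.norm_of_nonneg (by positivity), ← mul_inv, ← mul_pow]
    gcongr
    linarith
  exact (Set.finite_singleton (0 : ℤ)).subset this

theorem resolventSum_pos {θ : ℝ} (hθ : 0 < θ) : 0 < resolventSum θ :=
  (summable_resolvent hθ).tsum_pos (fun _ => by positivity) 0 (by simp)

namespace IsLinearSolution

variable {ω₀ γ θ : ℝ} {N : ℕ} {g q : Site N → ℝ → ℝ}

/-- Amplitude bound: the factor depends on the chain only through the spectral gap. -/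
theorem wsum_le (h : IsLinearSolution ω₀ γ θ g q) (hθ : 0 < θ)
    (hg : ∀ x, Continuous (g x)) {κ c : ℝ} {w : ℤ → ℝ} (hw : IsWeight κ w) (hκ : 0 ≤ κ)
    (hc : 0 < c) (hκc : κ ≤ c / 2) (hgap : SpectralGap ω₀ θ c) {G : ℝ}
    (hG : ∀ m, csum w (fun x => fcoeff θ (g x) m) ≤ G) (t : ℝ) :
    wsum w (fun x => q x t) ≤ (2 / c * resolventSum θ) ^ 2 * G := by
  have hG0 : 0 ≤ G := (csum_nonneg _ _).trans (hG 0)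
  have hm : ∀ m, csum w (fun x => fcoeff θ (q x) m) ≤
      (2 / c * √G * (1 + (m * freq θ) ^ 2)⁻¹) ^ 2 := by
    intro m
    refine (h.csum_fcoeff_le hθ hg hw hκ hc hκc hgap m).trans ?_
    have hGm := hG m
    set l := 1 + (m * freq θ) ^ 2 with hl
    have hl0 : 0 < l := by positivity
    calc 4 * csum w (fun x => fcoeff θ (g x) m) / (c * l) ^ 2 ≤ 4 * √G ^ 2 / (c * l) ^ 2 := by
          rw [Real.sq_sqrt hG0]; gcongr
      _ = _ := by field_simp; ring
  have hsum : Summable fun m : ℤ => 2 / c * √G * (1 + (m * freq θ) ^ 2)⁻¹ :=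
    (summable_resolvent hθ).mul_left _
  have hx : ∀ (x : Site N) m, w x * ‖fcoeff θ (q x) m‖ ≤ 2 / c * √G * (1 + (m * freq θ) ^ 2)⁻¹ := by
    intro x m
    refine le_of_sq_le_sq ?_ (by positivity)
    rw [mul_pow]
    exact (sq_le_csum w (fun x => fcoeff θ (q x) m) x).trans (hm m)
  have hs : ∀ x, Summable (fcoeff θ (q x)) := by
    intro x
    refine Summable.of_norm ?_
    refine (summable_mul_left_iff (hw.pos x).ne').1 ?_
    exact Summable.of_nonneg_of_le (fun m => mul_nonneg (hw.pos x).le (norm_nonneg _)) (hx x) hsum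
  -- The triangle inequality is applied to the whole weighted vector in `ℓ²`, rather than site by
  -- site, so no factor of `N` appears.
  have hvec : HasSum (fun m => (WithLp.toLp 2 fun x : Site N =>
      (w x : ℂ) * (fcoeff θ (q x) m * character θ m t) : EuclideanSpace ℂ (Site N)))
      (WithLp.toLp 2 fun x : Site N => (w x : ℂ) * (q x t : ℂ)) := by
    have hpi : HasSum (fun m => fun x : Site N => (w x : ℂ) * (fcoeff θ (q x) m * character θ m t))
        (fun x : Site N => (w x : ℂ) * (q x t : ℂ)) :=
      Pi.hasSum.2 fun x =>
        (hasSum_fcoeff hθ (h.continuous x) (h.periodic x) (hs x) t).mul_left _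
    exact (PiLp.continuousLinearEquiv 2 ℂ (fun _ : Site N => ℂ)).symm.hasSum.2 hpi
  have hnorm := hvec.norm_le_of_bounded (hsum.hasSum) fun m => by
    rw [EuclideanSpace.norm_eq, Real.sqrt_le_left (by positivity)]
    refine le_trans (le_of_eq ?_) (hm m)
    refine Finset.sum_congr rfl fun x _ => ?_
    simp [norm_character, mul_pow]
  rw [tsum_mul_left, EuclideanSpace.norm_eq, Real.sqrt_le_left] at hnorm
  · refine le_trans (le_of_eq ?_) (hnorm.trans (le_of_eq ?_))
    · refine Finset.sum_congr rfl fun x _ => ?_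
      simp [mul_pow]
    · rw [resolventSum]
      rw [mul_pow, mul_pow, mul_pow, Real.sq_sqrt hG0]; ring
  · have := resolventSum_pos hθ
    rw [resolventSum] at this
    positivity

/-- Kinetic energy bound. -/
theorem integral_deriv_sq_le (h : IsLinearSolution ω₀ γ θ g q) (hθ : 0 < θ)
    (hg : ∀ x, Continuous (g x)) {κ c : ℝ} {w : ℤ → ℝ} (hw : IsWeight κ w) (hκ : 0 ≤ κ)
    (hc : 0 < c) (hκc : κ ≤ c / 2) (hgap : SpectralGap ω₀ θ c) {G : ℝ}
    (hG : ∀ m, csum w (fun x => fcoeff θ (g x) m) ≤ G) (x : Site N) :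
    w x ^ 2 * ∫ t in (0 : ℝ)..θ, deriv (q x) t ^ 2 ≤ 4 * θ / c ^ 2 * resolventSum θ * G := by
  have hG0 : 0 ≤ G := (csum_nonneg _ _).trans (hG 0)
  have hP := hasSum_sq_fcoeff hθ (h.continuous_deriv x)
  have hle : ∀ m : ℤ, w x ^ 2 * ‖fcoeff θ (deriv (q x)) m‖ ^ 2 ≤
      4 / c ^ 2 * G * (1 + (m * freq θ) ^ 2)⁻¹ := by
    intro m
    have h1 := (sq_le_csum w (fun x => fcoeff θ (q x) m) x).trans
      (h.csum_fcoeff_le hθ hg hw hκ hc hκc hgap m)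
    have h2 : ‖fcoeff θ (deriv (q x)) m‖ ^ 2 = (m * freq θ) ^ 2 * ‖fcoeff θ (q x) m‖ ^ 2 := by
      have : ((m : ℂ) * (freq θ : ℂ)) = ((m * freq θ : ℝ) : ℂ) := by push_cast; rfl
      rw [h.fcoeff_deriv hθ, this, norm_mul, norm_mul, Complex.norm_I, one_mul, Complex.norm_real,
        mul_pow, Real.norm_eq_abs, sq_abs]
    have hGm := hG m
    set l := (m * freq θ) ^ 2 with hl
    have hl0 : 0 ≤ l := sq_nonneg _
    -- The derivative costs `l = (mω)²`, and `l / (1 + l)² ≤ 1 / (1 + l)` is still summable.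
    calc w x ^ 2 * ‖fcoeff θ (deriv (q x)) m‖ ^ 2
        = l * (w x ^ 2 * ‖fcoeff θ (q x) m‖ ^ 2) := by rw [h2]; ring
      _ ≤ (1 + l) * (4 * csum w (fun x => fcoeff θ (g x) m) / (c * (1 + l)) ^ 2) := by
          gcongr; linarith
      _ ≤ (1 + l) * (4 * G / (c * (1 + l)) ^ 2) := by gcongr
      _ = _ := by field_simp
  have := hasSum_le hle (hP.mul_left (w x ^ 2)) ((summable_resolvent hθ).hasSum.mul_left _)
  rw [← resolventSum] at this
  calc w x ^ 2 * ∫ t in (0 : ℝ)..θ, deriv (q x) t ^ 2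
      = θ * (w x ^ 2 * (θ⁻¹ * ∫ t in (0 : ℝ)..θ, deriv (q x) t ^ 2)) := by field_simp
    _ ≤ θ * (4 / c ^ 2 * G * resolventSum θ) := by gcongr
    _ = _ := by ring

end IsLinearSolution

/-- By Parseval a single coefficient is bounded by the time mean of the square; this mean commutes
with the finite sum over sites. -/
theorem csum_fcoeff_le_of_wsum_le {θ : ℝ} (hθ : 0 < θ) {N : ℕ} (w : ℤ → ℝ) {g : Site N → ℝ → ℝ}
    (hg : ∀ x, Continuous (g x)) {S : ℝ} (hS : ∀ t, wsum w (fun x => g x t) ≤ S) (m : ℤ) :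
    csum w (fun x => fcoeff θ (g x) m) ≤ S := by
  have hcont : Continuous fun t => wsum w fun x => g x t := by
    unfold wsum; fun_prop
  calc csum w (fun x => fcoeff θ (g x) m)
      ≤ ∑ x : Site N, w x ^ 2 * (θ⁻¹ * ∫ t in (0 : ℝ)..θ, g x t ^ 2) :=
        Finset.sum_le_sum fun x _ =>
          mul_le_mul_of_nonneg_left (norm_fcoeff_sq_le hθ (hg x) m) (sq_nonneg _)
    _ = θ⁻¹ * ∫ t in (0 : ℝ)..θ, wsum w fun x => g x t := by
        simp only [wsum]
        rw [intervalIntegral.integral_finsetSum, Finset.mul_sum]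
        · refine Finset.sum_congr rfl fun x _ => ?_
          rw [intervalIntegral.integral_const_mul]; ring
        · exact fun x _ => Continuous.intervalIntegrable (by fun_prop) _ _
    _ ≤ θ⁻¹ * ∫ _ in (0 : ℝ)..θ, S := by
        gcongr
        exact intervalIntegral.integral_mono hθ.le (hcont.intervalIntegrable _ _)
          (continuous_const.intervalIntegrable _ _) hS
    _ = S := by simp; field_simp

/-! ### Existence for the harmonic chain. -/

theorem isWeight_one : IsWeight 0 fun _ => 1 := ⟨fun _ => one_pos, fun _ => by norm_num⟩

/-- The harmonic chain as a first order system for `(q, p)`. -/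
noncomputable def generator (ω₀ γ : ℝ) (N : ℕ) :
    ((Site N → ℝ) × (Site N → ℝ)) →L[ℝ] ((Site N → ℝ) × (Site N → ℝ)) :=
  LinearMap.toContinuousLinearMap
    { toFun := fun z => (z.2, fun x => lap z.1 x - ω₀ ^ 2 * z.1 x
        - γ * (delta (-(N : ℤ)) x + delta (N : ℤ) x) * z.2 x)
      map_add' := fun y z => by
        refine Prod.ext rfl (funext fun x => ?_)
        change lap (fun i => y.1 i + z.1 i) x - ω₀ ^ 2 * (y.1 x + z.1 x) -
          γ * (delta (-(N : ℤ)) x + delta (N : ℤ) x) * (y.2 x + z.2 x) = _ + _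
        simp only [lap, ext_add]
        ring
      map_smul' := fun a z => by
        refine Prod.ext rfl (funext fun x => ?_)
        have h : ∀ k, ext (fun i => a * z.1 i) k = a * ext z.1 k := fun _ => rfl
        change lap (fun i => a * z.1 i) x - ω₀ ^ 2 * (a * z.1 x) -
          γ * (delta (-(N : ℤ)) x + delta (N : ℤ) x) * (a * z.2 x) = a * _
        simp only [lap, h]
        ring }

theorem IsLinearSolution.of_firstOrder {ω₀ γ θ : ℝ} {N : ℕ} {g : Site N → ℝ → ℝ}
    {z : ℝ → (Site N → ℝ) × (Site N → ℝ)}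
    (hz : ∀ t, HasDerivAt z (generator ω₀ γ N (z t) + (0, fun x => g x t)) t)
    (hp : Function.Periodic z θ) :
    IsLinearSolution ω₀ γ θ g (fun x t => (z t).1 x) ∧
      ∀ x, deriv (fun t => (z t).1 x) = fun t => (z t).2 x := by
  have h1 : ∀ x t, HasDerivAt (fun t => (z t).1 x) ((z t).2 x) t := fun x t => by
    have := hasDerivAt_pi.1 (hz t).fst x
    simpa [generator] using this
  have h2 : ∀ x, deriv (fun t => (z t).1 x) = fun t => (z t).2 x := fun x =>
    funext fun t => (h1 x t).deriv
  refine ⟨⟨fun x t => (h1 x t).differentiableAt, fun x t => ?_, fun x t => ?_⟩, h2⟩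
  · rw [h2]
    exact hasDerivAt_pi.1 (hz t).snd x
  · simp only [hp t]

theorem IsLinearSolution.eq_zero {ω₀ γ θ : ℝ} (hθ : 0 < θ) {N : ℕ} {q : Site N → ℝ → ℝ}
    (h : IsLinearSolution ω₀ γ θ (fun _ _ => 0) q) {c : ℝ} (hc : 0 < c)
    (hgap : SpectralGap ω₀ θ c) (x : Site N) (t : ℝ) : q x t = 0 := by
  have h1 := h.wsum_le hθ (fun _ => continuous_const) isWeight_one le_rfl hc (by positivity) hgap
    (G := 0) (csum_fcoeff_le_of_wsum_le hθ _ (fun _ => continuous_const) (by simp [wsum])) t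
  have h2 := (sq_le_wsum (fun _ => 1) (fun x => q x t) x).trans h1
  simpa using h2

open NormedSpace in
/-- The harmonic chain has a periodic solution for every continuous periodic force. -/
theorem exists_isLinearSolution {ω₀ γ θ : ℝ} (hθ : 0 < θ) {c : ℝ} (hc : 0 < c)
    (hgap : SpectralGap ω₀ θ c) {N : ℕ} {g : Site N → ℝ → ℝ} (hg : ∀ x, Continuous (g x))
    (hgp : ∀ x, Function.Periodic (g x) θ) : ∃ q, IsLinearSolution ω₀ γ θ g q := by
  set Z := (Site N → ℝ) × (Site N → ℝ) with hZ
  set A : Z →L[ℝ] Z := generator ω₀ γ N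
  let E : ℝ → (Z →L[ℝ] Z) := fun t => exp (t • A)
  have hE : ∀ t, HasDerivAt E (A * E t) t := fun t => hasDerivAt_exp_smul_const' A t
  have hEc : Continuous E := continuous_iff_continuousAt.2 fun t => (hE t).continuousAt
  have hadd : ∀ s t, E (s + t) = E s * E t := fun s t => by
    let _ : NormedAlgebra ℚ (Z →L[ℝ] Z) := NormedAlgebra.restrictScalars ℚ ℝ _
    simp only [E, add_smul]
    exact exp_add_of_commute (((Commute.refl A).smul_left s).smul_right t)
  have hE0 : E 0 = 1 := by simp [E]
  -- A fixed vector of the monodromy map `E θ` generates a periodic solution of the unforced chain,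
  -- which vanishes by the a priori bound. Injectivity then gives surjectivity in finite dimension.
  have hinj : Function.Injective (1 - E θ : Z →L[ℝ] Z) := by
    rw [injective_iff_map_eq_zero]
    intro v hv
    have hv' : E θ v = v := by
      have : v - E θ v = 0 := by simpa using hv
      exact (sub_eq_zero.1 this).symm
    obtain ⟨hs, hd⟩ := IsLinearSolution.of_firstOrder (ω₀ := ω₀) (γ := γ) (θ := θ)
      (g := fun (_ : Site N) _ => 0)
      (z := fun t => E t v) (fun t => by
        refine ((hE t).clm_apply (hasDerivAt_const t v)).congr_deriv ?_
        change A (E t v) + E t 0 = A (E t v) + 0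
        simp) (fun t => by
        change E (t + θ) v = E t v
        rw [hadd, mul_apply_eq_comp, hv'])
    have hq := hs.eq_zero hθ hc hgap
    have hp : ∀ x t, (E t v).2 x = 0 := fun x t => by
      rw [← congrFun (hd x) t, show (fun t => (E t v).1 x) = fun _ => 0 from funext (hq x)]
      simp
    have : E 0 v = v := by rw [hE0]; rfl
    rw [← this]
    exact Prod.ext (funext fun x => hq x 0) (funext fun x => hp x 0)
  have hsurj : Function.Surjective (1 - E θ : Z →L[ℝ] Z) :=
    LinearMap.surjective_of_injective (f := ((1 - E θ : Z →L[ℝ] Z) : Z →ₗ[ℝ] Z)) hinj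
  let h : ℝ → Z := fun t => (0, fun x => g x t)
  have hh : Continuous h := continuous_const.prodMk (continuous_pi hg)
  have hcont : Continuous fun s => E (-s) (h s) := (hEc.comp continuous_neg).clm_apply hh
  -- This initial datum closes up the Duhamel solution: `z θ = z 0` amounts to `(1 - E θ) v = E θ ∫
  -- E(-s) h(s) ds`.
  obtain ⟨v, hv⟩ := hsurj (E θ (∫ s in (0 : ℝ)..θ, E (-s) (h s)))
  let z : ℝ → Z := fun t => E t (v + ∫ s in (0 : ℝ)..t, E (-s) (h s))
  have hz : ∀ t, HasDerivAt z (A (z t) + h t) t := fun t => by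
    have hint : HasDerivAt (fun t => v + ∫ s in (0 : ℝ)..t, E (-s) (h s)) (E (-t) (h t)) t :=
      (intervalIntegral.integral_hasDerivAt_right (hcont.intervalIntegrable _ _)
        (hcont.stronglyMeasurableAtFilter _ _) hcont.continuousAt).const_add v
    refine ((hE t).clm_apply hint).congr_deriv ?_
    change A (z t) + (E t * E (-t)) (h t) = _
    rw [← hadd, add_neg_cancel, hE0]
    rfl
  have hz0 : z θ = z 0 := by
    have h1 : v - E θ v = E θ (∫ s in (0 : ℝ)..θ, E (-s) (h s)) := hv
    simp only [z, intervalIntegral.integral_same, hE0, map_add, ← h1]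
    simp
  have hper : Function.Periodic z θ := by
    -- The shifted path solves the same equation because the force is periodic, and it agrees with
    -- `z` at time `0`.
    have := ODE_solution_unique_univ (t₀ := 0) (f := fun t => z (t + θ)) (g := z)
      (v := fun t y => A y + h t) (s := fun _ => Set.univ) (K := ‖A‖₊)
      (fun t => by
        refine LipschitzWith.lipschitzOnWith ?_
        exact LipschitzWith.of_dist_le_mul fun y y' => by
          rw [dist_add_right]; exact A.lipschitz.dist_le_mul y y')
      (fun t => ⟨by
        have := (hz (t + θ)).comp_add_const t θ
        have hp : h (t + θ) = h t := by simp only [h, hgp _ t]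
        rwa [hp] at this, Set.mem_univ _⟩)
      (fun t => ⟨hz t, Set.mem_univ _⟩) (by simpa using hz0)
    exact fun t => congrFun this t
  exact ⟨_, (IsLinearSolution.of_firstOrder hz hper).1⟩

/-! ### The spectral gap and the exponential weight. -/

/-- The distance `δ_*` from the band is upgraded to a gap growing like `1 + (mω)²`. No `(mω)²` lies
inside the squared band, as the distance would be zero; below it `(mω)² < ω₀²`, and above it the
excess over `ω₀² + 4` is at least `δ_*`. The denominator of the constant covers both sides. -/
theorem spectralGap_of_deltaStar_pos {ω₀ θ : ℝ} (hω₀ : 0 < ω₀) (h : 0 < deltaStar ω₀ θ) :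
    SpectralGap ω₀ θ (deltaStar ω₀ θ / (deltaStar ω₀ θ + 1 + ω₀ ^ 2 + 4)) := by
  have hle : ∀ m : ℤ, ∀ w ∈ Set.Icc ω₀ √(ω₀ ^ 2 + 4),
      deltaStar ω₀ θ ≤ |((m : ℝ) * freq θ) ^ 2 - w ^ 2| := fun m w hw =>
    csInf_le ⟨0, by rintro _ ⟨_, _, _, rfl⟩; exact abs_nonneg _⟩ ⟨m, w, hw, rfl⟩
  have hs : ω₀ ≤ √(ω₀ ^ 2 + 4) := Real.le_sqrt_of_sq_le (by linarith)
  intro m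
  set d := deltaStar ω₀ θ
  set l := ((m : ℝ) * freq θ) ^ 2
  have hl : 0 ≤ l := sq_nonneg _
  rw [div_mul_eq_mul_div, div_le_iff₀ (by positivity), div_le_iff₀ (by positivity)]
  rcases lt_or_ge l (ω₀ ^ 2) with h1 | h1
  · left
    have h2 := hle m ω₀ ⟨le_rfl, hs⟩
    rw [abs_of_neg (by linarith)] at h2
    nlinarith
  · right
    rcases le_or_gt l (ω₀ ^ 2 + 4) with h2 | h2
    · have h3 := hle m (√l) ⟨Real.le_sqrt_of_sq_le h1, Real.sqrt_le_sqrt h2⟩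
      rw [Real.sq_sqrt hl, sub_self, abs_zero] at h3
      linarith
    · have h3 := hle m _ ⟨hs, le_rfl⟩
      rw [Real.sq_sqrt (by positivity), abs_of_pos (by linarith)] at h3
      nlinarith [sq_nonneg ω₀]

/-- The ratio of neighbouring weights is `exp (±s)` with `|s| ≤ |ρ|`, and `2 cosh s ≤ 2 cosh ρ`. -/
theorem isWeight_exp (ρ : ℝ) :
    IsWeight (2 * Real.cosh ρ - 2) fun x => Real.exp (ρ * |(x : ℝ)|) := by
  refine ⟨fun x => Real.exp_pos _, fun x => ?_⟩
  set a := |(x : ℝ)|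
  set b := |((x + 1 : ℤ) : ℝ)|
  have hab : |ρ * (a - b)| ≤ |ρ| := by
    rw [abs_mul]
    refine mul_le_of_le_one_right (abs_nonneg _) ((abs_abs_sub_abs_le _ _).trans ?_)
    push_cast
    simp
  have hc := mul_le_mul_of_nonneg_left (Real.cosh_le_cosh.2 hab) (Real.exp_pos (ρ * (a + b))).le
  have e1 : Real.exp (ρ * a) ^ 2 = Real.exp (ρ * (a + b)) * Real.exp (ρ * (a - b)) := by
    rw [← Real.exp_add, sq, ← Real.exp_add]; ring_nf
  have e2 : Real.exp (ρ * b) ^ 2 = Real.exp (ρ * (a + b)) * Real.exp (-(ρ * (a - b))) := by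
    rw [← Real.exp_add, sq, ← Real.exp_add]; ring_nf
  have e3 : Real.exp (ρ * a) * Real.exp (ρ * b) = Real.exp (ρ * (a + b)) := by
    rw [← Real.exp_add]; ring_nf
  rw [Real.cosh_eq (ρ * (a - b))] at hc
  rw [e1, e2, e3]
  linarith

theorem exists_rate {ε : ℝ} (hε : 0 < ε) : ∃ ρ : ℝ, 0 < ρ ∧ 2 * Real.cosh ρ - 2 ≤ ε := by
  have h : Filter.Tendsto (fun ρ => 2 * Real.cosh ρ - 2) (nhds 0) (nhds (2 * Real.cosh 0 - 2)) :=
    ((Real.continuous_cosh.const_mul 2).sub continuous_const).tendsto 0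
  rw [Real.cosh_zero, mul_one, sub_self] at h
  have h' := (h.eventually (gt_mem_nhds hε)).filter_mono
    (nhdsWithin_le_nhds (s := Set.Ioi (0 : ℝ)))
  obtain ⟨ρ, h1, h2⟩ := (h'.and self_mem_nhdsWithin).exists
  exact ⟨ρ, h2, h1.le⟩

theorem exists_max_of_periodic {θ : ℝ} (hθ : 0 < θ) {f : ℝ → ℝ} (hf : Continuous f)
    (hp : Function.Periodic f θ) : ∃ t₀, ∀ t, f t ≤ f t₀ := by
  obtain ⟨t₀, -, h⟩ := (isCompact_Icc (a := 0) (b := θ)).exists_isMaxOn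
    (Set.nonempty_Icc.2 hθ.le) hf.continuousOn
  refine ⟨t₀, fun t => ?_⟩
  obtain ⟨s, hs, e⟩ := hp.exists_mem_Ico₀ hθ t
  rw [e]
  exact h ⟨hs.1, hs.2.le⟩

/-! ### The nonlinear chain: fixed point and decay. -/

/-- The nonlinear term together with the external force, along the configuration `q`. -/
noncomputable def source (θ : ℝ) (V U : ℝ → ℝ) (F : ℤ → ℂ) {N : ℕ} (ν : ℝ)
    (q : Site N → ℝ → ℝ) (x : Site N) (t : ℝ) : ℝ :=
  -ν * anharm V U (fun y => q y t) x + force θ F t * delta 0 x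

theorem isPeriodicSolution_iff {ω₀ γ θ : ℝ} {V U : ℝ → ℝ} {F : ℤ → ℂ} {N : ℕ} {ν : ℝ}
    {q : Site N → ℝ → ℝ} : IsPeriodicSolution ω₀ γ θ V U F N ν q ↔
      IsLinearSolution ω₀ γ θ (source θ V U F ν q) q :=
  ⟨fun h => ⟨h.differentiable, fun x t => (h.equation x t).congr_deriv (by rw [source]; ring),
    h.periodic⟩,
  fun h => ⟨h.differentiable, fun x t => (h.equation x t).congr_deriv (by rw [source]; ring),
    h.periodic⟩⟩

theorem continuous_anharm {V U : ℝ → ℝ} (hV : IsPotential V) (hU : IsPotential U) {N : ℕ}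
    {q : Site N → ℝ → ℝ} (hq : ∀ x, Continuous (q x)) (x : Site N) :
    Continuous fun t => anharm V U (fun y => q y t) x := by
  have h : ∀ z, Continuous fun t => ext (fun y => q y t) z := fun z => hq _
  have hV' := hV.continuous_deriv
  have hU' := hU.continuous_deriv
  have hx := hq x
  unfold anharm grad
  exact (hV'.comp hx).sub
    ((hU'.comp ((h _).sub (h _))).sub (hU'.comp ((h _).sub (h _))))

section Nonlinear

variable {ω₀ γ θ : ℝ} {V U : ℝ → ℝ} {F : ℤ → ℂ} {N : ℕ} {ν : ℝ}

theorem continuous_source (hV : IsPotential V) (hU : IsPotential U) (hF : IsForcing F)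
    {q : Site N → ℝ → ℝ} (hq : ∀ x, Continuous (q x)) (x : Site N) :
    Continuous (source θ V U F ν q x) :=
  (continuous_const.mul (continuous_anharm hV hU hq x)).add
    ((hF.continuous_force θ).mul continuous_const)

theorem source_periodic (hθ : 0 < θ) {q : Site N → ℝ → ℝ}
    (hq : ∀ x, Function.Periodic (q x) θ) (x : Site N) :
    Function.Periodic (source θ V U F ν q x) θ := by
  intro t
  simp only [source, hq _ t, force_periodic hθ F t]

theorem IsLinearSolution.sub {g g' q q' : Site N → ℝ → ℝ} (h : IsLinearSolution ω₀ γ θ g q)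
    (h' : IsLinearSolution ω₀ γ θ g' q') :
    IsLinearSolution ω₀ γ θ (fun x t => g x t - g' x t) fun x t => q x t - q' x t := by
  refine ⟨fun x => (h.differentiable x).sub (h'.differentiable x), fun x t => ?_,
    fun x => (h.periodic x).sub (h'.periodic x)⟩
  have e : deriv (fun t => q x t - q' x t) = fun t => deriv (q x) t - deriv (q' x) t :=
    funext fun t => deriv_fun_sub (h.differentiable x t) (h'.differentiable x t)
  rw [e]
  refine ((h.equation x t).sub (h'.equation x t)).congr_deriv ?_
  simp only [lap, ext_sub]
  ring

/-- Contraction estimate for the map sending `p` to the response to `source p`. -/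
theorem wsum_sub_le_of_source (hθ : 0 < θ) {κ c K : ℝ} {w : ℤ → ℝ} (hw : IsWeight κ w)
    (hκ : 0 ≤ κ) (hκ1 : κ ≤ 1) (hc : 0 < c) (hκc : κ ≤ c / 2) (hgap : SpectralGap ω₀ θ c)
    (hV : IsPotential V) (hU : IsPotential U) (hK : frakV V U ≤ K) (hF : IsForcing F)
    {p p' q q' : Site N → ℝ → ℝ} (hp : ∀ x, Continuous (p x)) (hp' : ∀ x, Continuous (p' x))
    (h : IsLinearSolution ω₀ γ θ (source θ V U F ν p) q)
    (h' : IsLinearSolution ω₀ γ θ (source θ V U F ν p') q') {S : ℝ}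
    (hS : ∀ t, wsum w (fun x => p x t - p' x t) ≤ S) (t : ℝ) :
    wsum w (fun x => q x t - q' x t) ≤
      (2 / c * resolventSum θ) ^ 2 * (63 * K ^ 2 * ν ^ 2) * S := by
  have hcont : ∀ x, Continuous fun t => source θ V U F ν p x t - source θ V U F ν p' x t :=
    fun x => (continuous_source hV hU hF hp x).sub (continuous_source hV hU hF hp' x)
  have hb : ∀ t, wsum w (fun x => source θ V U F ν p x t - source θ V U F ν p' x t) ≤
      63 * K ^ 2 * ν ^ 2 * S := fun t => by
    have e : (fun x : Site N => source θ V U F ν p x t - source θ V U F ν p' x t) = fun x =>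
        -ν * (anharm V U (fun y => p y t) x - anharm V U (fun y => p' y t) x) := by
      funext x; simp only [source]; ring
    rw [e, wsum_const_mul, neg_sq]
    have h1 := hw.wsum_anharm_sub_le hκ1 hV hU hK (fun y : Site N => p y t) fun y => p' y t
    calc ν ^ 2 * _ ≤ ν ^ 2 * (63 * K ^ 2 * wsum w fun x => p x t - p' x t) := by gcongr
      _ ≤ ν ^ 2 * (63 * K ^ 2 * S) := by gcongr; exact hS t
      _ = _ := by ring
  have := (h.sub h').wsum_le hθ hcont hw hκ hc hκc hgap
    (csum_fcoeff_le_of_wsum_le hθ w hcont hb) t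
  rwa [← mul_assoc] at this

/-- At a time where the squared distance `S` of two solutions is maximal, the contraction estimate
reads `S ≤ S/4`. -/
theorem IsPeriodicSolution.unique (hθ : 0 < θ) {c K : ℝ} (hc : 0 < c)
    (hgap : SpectralGap ω₀ θ c) (hV : IsPotential V) (hU : IsPotential U) (hK : frakV V U ≤ K)
    (hF : IsForcing F)
    (hν : (2 / c * resolventSum θ) ^ 2 * (63 * K ^ 2 * ν ^ 2) ≤ 1 / 4)
    {q q' : Site N → ℝ → ℝ} (h : IsPeriodicSolution ω₀ γ θ V U F N ν q)
    (h' : IsPeriodicSolution ω₀ γ θ V U F N ν q') : q = q' := by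
  have hq := fun x => (h.differentiable x).continuous
  have hq' := fun x => (h'.differentiable x).continuous
  obtain ⟨t₀, ht₀⟩ := exists_max_of_periodic hθ
    (f := fun t => wsum (fun _ => 1) fun x => q x t - q' x t) (by unfold wsum; fun_prop)
    (fun t => by simp only [h.periodic _ t, h'.periodic _ t])
  have h1 := wsum_sub_le_of_source hθ isWeight_one le_rfl zero_le_one hc (by positivity) hgap hV hU
    hK hF hq hq' (isPeriodicSolution_iff.1 h) (isPeriodicSolution_iff.1 h') ht₀ t₀
  have h2 := wsum_nonneg (fun _ => 1) fun x => q x t₀ - q' x t₀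
  have h3 := mul_le_mul_of_nonneg_right hν h2
  funext x t
  have h4 := (sq_le_wsum (fun _ => 1) (fun x => q x t - q' x t) x).trans (ht₀ t)
  simp only [one_pow, one_mul] at h4
  exact sub_eq_zero.1 (pow_eq_zero_iff (two_ne_zero)|>.1 (le_antisymm (by linarith) (sq_nonneg _)))

/-- Periodic paths become points of a complete metric space; the Euclidean norm is chosen so that
squared distances are `wsum` with weight `1`. -/
theorem exists_circle_lift {q : Site N → ℝ → ℝ} (hq : ∀ x, Continuous (q x))
    (hp : ∀ x, Function.Periodic (q x) θ) :
    ∃ u : C(AddCircle θ, EuclideanSpace ℝ (Site N)), ∀ x (t : ℝ), u (t : AddCircle θ) x = q x t := by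
  let f : ℝ → EuclideanSpace ℝ (Site N) := fun t => WithLp.toLp 2 fun x => q x t
  have hfp : Function.Periodic f θ := fun t => by simp only [f, hp _ t]
  have hfc : Continuous f := (PiLp.continuous_toLp 2 _).comp (continuous_pi hq)
  refine ⟨⟨hfp.lift, continuous_coinduced_dom.2 hfc⟩, fun x t => ?_⟩
  change hfp.lift (t : AddCircle θ) x = _
  rw [hfp.lift_coe]

theorem exists_isPeriodicSolution (hθ : 0 < θ) {c K : ℝ} (hc : 0 < c)
    (hgap : SpectralGap ω₀ θ c) (hV : IsPotential V) (hU : IsPotential U) (hK : frakV V U ≤ K)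
    (hF : IsForcing F)
    (hν : (2 / c * resolventSum θ) ^ 2 * (63 * K ^ 2 * ν ^ 2) ≤ 1 / 4) :
    ∃ q, IsPeriodicSolution ω₀ γ θ V U F N ν q := by
  have : Fact (0 < θ) := ⟨hθ⟩
  let path (u : C(AddCircle θ, EuclideanSpace ℝ (Site N))) (x : Site N) (t : ℝ) : ℝ :=
    u (t : AddCircle θ) x
  have hcont : ∀ u x, Continuous (path u x) := fun u x =>
    (EuclideanSpace.proj (𝕜 := ℝ) x).continuous.comp
      (u.continuous.comp (AddCircle.continuous_mk' θ))
  have hper : ∀ u x, Function.Periodic (path u x) θ := fun u x t => by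
    simp only [path, AddCircle.coe_add_period]
  have hstep : ∀ u, ∃ v, IsLinearSolution ω₀ γ θ (source θ V U F ν (path u)) (path v) := fun u => by
    obtain ⟨q, hq⟩ := exists_isLinearSolution (ω₀ := ω₀) (γ := γ) hθ hc hgap
      (continuous_source (θ := θ) (ν := ν) hV hU hF (hcont u))
      (source_periodic (V := V) (U := U) (F := F) (ν := ν) hθ (hper u))
    obtain ⟨v, hv⟩ := exists_circle_lift hq.continuous hq.periodic
    refine ⟨v, ?_⟩
    rwa [show path v = q from funext fun x => funext fun t => hv x t]
  choose Φ hΦ using hstep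
  have hdist : ∀ u v (t : ℝ), wsum (fun _ => 1) (fun x => path u x t - path v x t)
      = dist (u (t : AddCircle θ)) (v (t : AddCircle θ)) ^ 2 := fun u v t => by
    rw [EuclideanSpace.dist_eq, Real.sq_sqrt (Finset.sum_nonneg fun _ _ => by positivity), wsum]
    refine Finset.sum_congr rfl fun x _ => ?_
    rw [Real.dist_eq, sq_abs, one_pow, one_mul]
  -- The bound `1/4` concerns squared distances, hence the ratio `1/2`.
  have hΦc : ContractingWith (1 / 2) Φ := by
    refine ⟨by norm_num, LipschitzWith.of_dist_le_mul fun u v => ?_⟩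
    rw [ContinuousMap.dist_le (by positivity)]
    intro a
    obtain ⟨t, rfl⟩ := QuotientAddGroup.mk_surjective a
    have h1 := wsum_sub_le_of_source hθ isWeight_one le_rfl zero_le_one hc (by positivity) hgap
      hV hU hK hF (hcont u) (hcont v) (hΦ u) (hΦ v) (S := dist u v ^ 2) (fun s => by
        rw [hdist]
        exact pow_le_pow_left₀ dist_nonneg (ContinuousMap.dist_apply_le_dist _) 2) t
    rw [hdist] at h1
    refine le_of_sq_le_sq (h1.trans ?_) (by positivity)
    refine (mul_le_mul_of_nonneg_right hν (sq_nonneg _)).trans (le_of_eq ?_)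
    rw [mul_pow]
    norm_num
  have hfix : Φ (ContractingWith.fixedPoint Φ hΦc) = ContractingWith.fixedPoint Φ hΦc :=
    hΦc.fixedPoint_isFixedPt
  refine ⟨path (ContractingWith.fixedPoint Φ hΦc), isPeriodicSolution_iff.2 ?_⟩
  have h := hΦ (ContractingWith.fixedPoint Φ hΦc)
  rwa [hfix] at h

theorem csum_force (hθ : 0 < θ) (hF : IsForcing F) (w : ℤ → ℝ) (m : ℤ) :
    csum w (fun x : Site N => fcoeff θ (fun t => force θ F t * delta 0 x) m)
      = w 0 ^ 2 * ‖F m‖ ^ 2 := by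
  have h0 : (0 : ℤ) ∈ Set.Icc (-(N : ℤ)) N := ⟨by omega, by omega⟩
  have e : ∀ x : Site N, fcoeff θ (fun t => force θ F t * delta 0 x) m = delta 0 x * F m :=
    fun x => by simp only [mul_comm _ (delta 0 x)]; rw [fcoeff_const_mul, hF.fcoeff_force hθ]
  simp only [csum, e]
  rw [Finset.sum_eq_single (⟨0, h0⟩ : Site N)]
  · simp [delta]
  · intro x _ hx
    have : (x : ℤ) ≠ 0 := fun h => hx (Subtype.ext h)
    simp [delta, this]
  · intro h; exact absurd (Finset.mem_univ _) h

/-- The forcing seen by a periodic solution is bounded, mode by mode, by the force alone. -/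
theorem IsPeriodicSolution.csum_source_le (hθ : 0 < θ) {κ c K M : ℝ} {w : ℤ → ℝ}
    (hw : IsWeight κ w) (hw0 : w 0 = 1) (hκ : 0 ≤ κ) (hκ1 : κ ≤ 1) (hc : 0 < c)
    (hκc : κ ≤ c / 2) (hgap : SpectralGap ω₀ θ c)
    (hV : IsPotential V) (hU : IsPotential U) (hV0 : deriv V 0 = 0) (hK : frakV V U ≤ K)
    (hF : IsForcing F) (hM : ∀ m, ‖F m‖ ≤ M)
    (hν : (2 / c * resolventSum θ) ^ 2 * (63 * K ^ 2 * ν ^ 2) ≤ 1 / 4)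
    {q : Site N → ℝ → ℝ} (h : IsPeriodicSolution ω₀ γ θ V U F N ν q) (m : ℤ) :
    csum w (fun x => fcoeff θ (source θ V U F ν q x) m) ≤ 4 * M ^ 2 := by
  have hq := fun x => (h.differentiable x).continuous
  have hl := isPeriodicSolution_iff.1 h
  -- The maximum over time of the weighted norm is finite since the chain is finite; it is bounded
  -- independently of `N` only by the absorption below.
  obtain ⟨t₀, ht₀⟩ := exists_max_of_periodic hθ
    (f := fun t => wsum w fun x => q x t) (by unfold wsum; fun_prop)
    (fun t => by simp only [h.periodic _ t])
  set S := wsum w fun x => q x t₀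
  have hS : 0 ≤ S := wsum_nonneg _ _
  have han : ∀ x, Continuous fun t => -ν * anharm V U (fun y => q y t) x := fun x =>
    continuous_const.mul (continuous_anharm hV hU hq x)
  have hW : ∀ t, wsum w (fun x => -ν * anharm V U (fun y => q y t) x) ≤ 63 * K ^ 2 * ν ^ 2 * S := by
    intro t
    have h1 := hw.wsum_anharm_sub_le hκ1 hV hU hK (fun y : Site N => q y t) fun _ => 0
    simp only [anharm_zero hV0, sub_zero] at h1
    rw [wsum_const_mul, neg_sq]
    calc ν ^ 2 * _ ≤ ν ^ 2 * (63 * K ^ 2 * wsum w fun x => q x t) := by gcongr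
      _ ≤ ν ^ 2 * (63 * K ^ 2 * S) := by gcongr; exact ht₀ t
      _ = _ := by ring
  have hG : ∀ m, csum w (fun x => fcoeff θ (source θ V U F ν q x) m) ≤
      2 * (63 * K ^ 2 * ν ^ 2 * S) + 2 * M ^ 2 := by
    intro m
    have e : (fun x => fcoeff θ (source θ V U F ν q x) m) = fun x =>
        fcoeff θ (fun t => -ν * anharm V U (fun y => q y t) x) m
          + fcoeff θ (fun t => force θ F t * delta 0 x) m := funext fun x =>
      fcoeff_add (han x) ((hF.continuous_force θ).mul continuous_const) m
    have h1 := csum_fcoeff_le_of_wsum_le hθ w han hW m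
    have h2 := csum_force (N := N) hθ hF w m
    have h3 := pow_le_pow_left₀ (norm_nonneg _) (hM m) 2
    rw [hw0, one_pow, one_mul] at h2
    rw [e]
    refine (csum_add_le _ _ _).trans ?_
    rw [h2]
    linarith
  have hSle := hl.wsum_le hθ (continuous_source hV hU hF hq) hw hκ hc hκc hgap hG t₀
  change S ≤ _ at hSle
  set R := (2 / c * resolventSum θ) ^ 2
  set T := 63 * K ^ 2 * ν ^ 2
  have hT : 0 ≤ T := by positivity
  -- From `S ≤ R (2TS + 2M²)` and `RT ≤ 1/4`, half of `S` is absorbed on the left. Then `TS ≤ 4RT M²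
  -- ≤ M²`, so the source is at most `2M² + 2M²`.
  have h1 : S ≤ 4 * R * M ^ 2 := by nlinarith [mul_le_mul_of_nonneg_right hν hS]
  have h2 : T * S ≤ M ^ 2 := by
    nlinarith [mul_le_mul_of_nonneg_left h1 hT, mul_le_mul_of_nonneg_right hν (sq_nonneg M)]
  linarith [hG m]

end Nonlinear

end ForcedChain

/-! ### Choice of the constants and conclusion. -/

theorem mainTheorem4 (ω₀ γ θ : ℝ) (hω₀ : 0 < ω₀) (hγ : 0 < γ) (hθ : 0 < θ) (K M : ℝ) :
    ∃ C₁ A ρ : ℝ, 0 < C₁ ∧ 0 < A ∧ 0 < ρ ∧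
      ∀ (V U : ℝ → ℝ), ForcedChain.IsPotential V → ForcedChain.IsPotential U →
        deriv V 0 = 0 → ForcedChain.frakV V U ≤ K →
      ∀ F : ℤ → ℂ, ForcedChain.IsForcing F → (∀ m, ‖F m‖ ≤ M) →
      ∀ (N : ℕ) (ν : ℝ),
        ENNReal.ofReal |ν| < min (ForcedChain.nuZero ω₀ θ V U) (ENNReal.ofReal C₁) →
        ∃ q : ForcedChain.Site N → ℝ → ℝ,
          ForcedChain.IsPeriodicSolution ω₀ γ θ V U F N ν q ∧
          (∀ q' : ForcedChain.Site N → ℝ → ℝ,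
            ForcedChain.IsPeriodicSolution ω₀ γ θ V U F N ν q' → q' = q) ∧
          ∀ x : ForcedChain.Site N,
            (∀ t ∈ Set.Icc 0 θ, |q x t| ≤ A * Real.exp (-ρ * |((x : ℤ) : ℝ)|)) ∧
            ∫ t in (0 : ℝ)..θ, (deriv (q x) t) ^ 2 ≤ A * Real.exp (-ρ * |((x : ℤ) : ℝ)|) := by
  open ForcedChain in
  rcases le_or_gt (deltaStar ω₀ θ) 0 with hδ | hδ
  -- At resonance `ν₀ = 0`, so no `ν` is admissible and any constants do.
  · refine ⟨1, 1, 1, one_pos, one_pos, one_pos, fun V U _ _ _ _ F _ _ N ν hν => ?_⟩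
    simp [nuZero, ENNReal.ofReal_of_nonpos hδ] at hν
  have hgap := spectralGap_of_deltaStar_pos hω₀ hδ
  set c := deltaStar ω₀ θ / (deltaStar ω₀ θ + 1 + ω₀ ^ 2 + 4)
  have hc : 0 < c := by positivity
  obtain ⟨ρ, hρ, hρc⟩ := exists_rate (ε := min (c / 2) 1) (by positivity)
  have hκ : 0 ≤ 2 * Real.cosh ρ - 2 := by linarith [Real.one_le_cosh ρ]
  have hκ1 := hρc.trans (min_le_right _ _)
  have hκc := hρc.trans (min_le_left _ _)
  have hZ := resolventSum_pos hθ
  set r := 2 / c * resolventSum θ with hr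
  have hr0 : 0 < r := by positivity
  set E := 4 * θ / c ^ 2 * resolventSum θ * (4 * M ^ 2) with hE
  have hE0 : 0 ≤ E := by positivity
  -- `C₁` forces `r |K| |ν| ≤ 1/16`, whence the contraction constant is at most `63/256 < 1/4`. The
  -- term `2 r |M|` bounds the amplitude, being the root of `r² · 4M²`, and `E` bounds the kinetic
  -- integral; `+ 1` keeps `A` positive.
  refine ⟨1 / (16 * r * (|K| + 1)), 2 * r * |M| + E + 1, ρ, by positivity, by positivity, hρ,
    fun V U hV hU hV0 hK F hF hM N ν hν => ?_⟩
  have hνC : |ν| < 1 / (16 * r * (|K| + 1)) :=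
    (ENNReal.ofReal_lt_ofReal_iff (by positivity)).1 (lt_min_iff.1 hν).2
  have hsmall : r ^ 2 * (63 * K ^ 2 * ν ^ 2) ≤ 1 / 4 := by
    rw [lt_div_iff₀ (by positivity)] at hνC
    have h1 : |ν| * (r * |K|) ≤ 1 / 16 := by
      have : 0 ≤ |ν| * r := by positivity
      linarith
    have h2 := pow_le_pow_left₀ (by positivity) h1 2
    rw [mul_pow, mul_pow, sq_abs, sq_abs] at h2
    linarith
  obtain ⟨q, hq⟩ := exists_isPeriodicSolution (γ := γ) (N := N) hθ hc hgap hV hU hK hF hsmall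
  refine ⟨q, hq, fun q' hq' => hq'.unique hθ hc hgap hV hU hK hF hsmall hq, fun x => ?_⟩
  have hw := isWeight_exp ρ
  have hG := hq.csum_source_le hθ hw (by simp) hκ hκ1 hc hκc hgap hV hU hV0 hK hF hM hsmall
  have hl := isPeriodicSolution_iff.1 hq
  have hcont := continuous_source (θ := θ) (ν := ν) hV hU hF hl.continuous
  have hx : -ρ * |((x : ℤ) : ℝ)| = -(ρ * |((x : ℤ) : ℝ)|) := by ring
  set a := ρ * |((x : ℤ) : ℝ)| with ha
  have ha0 : 0 ≤ a := by positivity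
  have hmul : Real.exp (-a) * Real.exp a = 1 := by rw [← Real.exp_add]; simp
  rw [hx]
  refine ⟨fun t _ => ?_, ?_⟩
  · have h1 := (sq_le_wsum _ (fun x => q x t) x).trans
      (hl.wsum_le hθ hcont hw hκ hc hκc hgap hG t)
    have h2 : Real.exp a * |q x t| ≤ 2 * r * |M| := by
      refine le_of_sq_le_sq ?_ (by positivity)
      rw [mul_pow, mul_pow, sq_abs, sq_abs]
      refine h1.trans (le_of_eq ?_)
      rw [← hr]; ring
    calc |q x t| = Real.exp (-a) * (Real.exp a * |q x t|) := by rw [← mul_assoc, hmul, one_mul]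
      _ ≤ Real.exp (-a) * (2 * r * |M| + E + 1) := by gcongr; linarith
      _ = _ := mul_comm _ _
  · have h1 := hl.integral_deriv_sq_le hθ hcont hw hκ hc hκc hgap hG x
    have h0 : 0 ≤ ∫ t in (0 : ℝ)..θ, (deriv (q x) t) ^ 2 :=
      intervalIntegral.integral_nonneg hθ.le fun _ _ => sq_nonneg _
    set I := ∫ t in (0 : ℝ)..θ, (deriv (q x) t) ^ 2
    have h2 : Real.exp a * I ≤ E := by
      -- The kinetic bound carries the squared weight `exp (2a)`; only `exp a` is kept, so that one
      -- rate `ρ` serves both estimates.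
      refine le_trans (mul_le_mul_of_nonneg_right ?_ h0) h1
      exact le_self_pow₀ (Real.one_le_exp ha0) two_ne_zero
    have h3 : 0 ≤ 2 * r * |M| := by positivity
    calc I = Real.exp (-a) * (Real.exp a * I) := by rw [← mul_assoc, hmul, one_mul]
      _ ≤ Real.exp (-a) * (2 * r * |M| + E + 1) := by gcongr; linarith
      _ = _ := mul_comm _ _
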